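/- Let $\mathcal O$ be a discrete valuation ring with finite residue field (for instance the ring of integers of a non-archimedean local field) and maximal ideal $\mathfrak m$. Let $k,m,n\ge 0$ be integers with $m\le n/2$, and put $\mathcal O_k=\mathcal O/\mathfrak m^k$, $E=\mathcal O_k^n$, $G=\mathrm{Aut}_{\mathcal O_k}(E)$. For a partition $\lambda$ with at most $m$ parts, all of them $\le k$, a module is of type $\lambda$ if it is isomorphic to $\bigoplus_i\mathcal O/\mathfrak m^{\lambda_i}$. Write $\kappa\le\lambda$ if a module of type $\kappa$ embeds in a module of type $\lambda$; put $\phi=k^m=(k,\dots,k)$ and $\Phi=k^n$, so that these partitions are exactly the types $\lambda\le\phi$. Let $X_\lambda$ be the set of submodules of $E$ of type $\lambda$, $\mathcal F_\lambda=\mathbb C(X_\lambda)$ with the natural action of $G$, and $\mathcal H_\phi=\mathrm{End}_G(\mathcal F_\phi)$. For types $\lambda\le\mu$ let $U_\lambda^\mu:\mathcal F_\lambda\to\mathcal F_\mu$, $(U_\lambda^\mu h)(y)=\sum_{x\subseteq y}h(x)$, and $D_\mu^\lambda:\mathcal F_\mu\to\mathcal F_\lambda$, $(D_\mu^\lambda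 h)(x)=\sum_{y\supseteq x}h(y)$. Let $c_\lambda=U_\lambda^\phi D_\phi^\lambda\in\mathcal H_\phi$, and let $\mathcal H^\lambda$ and $\mathcal H^{\lambda^-}$ be the spans of the $c_{\lambda'}$ with $\lambda'\le\lambda$ and with $\lambda'<\lambda$, respectively. Let $[\kappa\prec\dot\lambda\prec\phi]$ be the number of submodules of type $\lambda$ between fixed submodules $x_\kappa\subseteq x_\phi$ of $E$ of types $\kappa$ and $\phi$. Let $[\lambda\prec\dot\phi\pitchfork\kappa]_\Phi$ be the number of submodules of $E$ of type $\phi$ that contain a fixed submodule $x_\lambda$ of type $\lambda$ and have zero intersection with a fixed submodule $x_\kappa$ of type $\kappa$, where $x_\lambda\cap x_\kappa=0$. Then, for all types $\kappa\le\lambda\le\phi$, such fixed submodules exist and both numbers are independent of their choice. The $c_\lambda$ form a basis of $\mathcal H_\phi$ (the cellular basis), and all $\mathcal H^\lambda$ and $\mathcal H^{\lambda^-}$ are ideals. For each $\kappa$ there is exactly one minimal idempotent $e_\kappa\in\mathcal H_\phi$ that acts as the identity on $K_\kappa=\mathcal H^\kappa/\mathcal H^{\kappa^-}$ and as $0$ on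 $K_\mu$ for every $\mu\ne\kappa$; the $e_\kappa$ form a basis of $\mathcal H_\phi$, and $$c_\lambda=\sum_{\kappa\le\lambda}A_{\lambda\kappa}\,e_\kappa,\qquad A_{\lambda\kappa}=[\kappa\prec\dot\lambda\prec\phi]\cdot[\lambda\prec\dot\phi\pitchfork\kappa]_\Phi .$$ Equivalently, every triple $\kappa\le\lambda\le\phi$ is good, in the following sense. For $S:\mathcal F_\kappa\to\mathcal F_\lambda$ put $\widehat S=U_\lambda^\phi\, S\, D_\phi^\kappa$. Then the operators $\widehat{U_\nu^\lambda D_\kappa^\nu}$, $\nu\le\kappa$, are a basis of the space of all $\widehat S$ with $S$ a $G$-equivariant map, and the coefficient of the member with index $\nu=\kappa$ (that is, of $\widehat{U_\kappa^\lambda}$) in the expansion of $\widehat{D_\phi^\lambda U_\kappa^\phi}$ is $[\lambda\prec\dot\phi\pitchfork\kappa]_\Phi$. -/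

import Mathlib

noncomputable section

namespace FiniteGrassmannian

open IsLocalRing

/-! ### Types of modules -/

/-- A type with at most `m` parts and height at most `k`: a partition
`k ≥ p 0 ≥ p 1 ≥ ⋯ ≥ p (m - 1) ≥ 0`, parts being allowed to vanish. -/
@[ext]
structure ModType (m k : ℕ) where
  /-- The parts of the partition. -/
  part : Fin m → ℕ
  antitone : Antitone part
  le_height : ∀ i, part i ≤ k

instance (m k : ℕ) : Finite (ModType m k) :=
  Finite.of_injective
    (fun p : ModType m k => fun i => (⟨p.part i, Nat.lt_succ_of_le (p.le_height i)⟩ : Fin (k + 1)))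
    (fun p q h => ModType.ext (funext fun i => congrArg Fin.val (congrFun h i)))

instance (m k : ℕ) : Fintype (ModType m k) := Fintype.ofFinite _

/-- The rectangular type `k ^ m = (k, …, k)`. -/
def rect (m k : ℕ) : ModType m k where
  part := fun _ => k
  antitone := fun _ _ _ => le_rfl
  le_height := fun _ => le_rfl

section Modules

variable (O : Type*) [CommRing O] [IsLocalRing O]

/-- The model module `⨁ i, O / 𝔪 ^ (p i)` of type `p`. -/
abbrev StdModule {m k : ℕ} (p : ModType m k) : Type _ :=
  (i : Fin m) → O ⧸ (maximalIdeal O ^ p.part i)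

/-- The partial order on types: a module of type `p` embeds in a module of type `q`. -/
def TypeLE {m k : ℕ} (p q : ModType m k) : Prop :=
  ∃ f : StdModule O p →ₗ[O] StdModule O q, Function.Injective f

theorem TypeLE.refl {m k : ℕ} (p : ModType m k) : TypeLE O p p :=
  ⟨LinearMap.id, Function.injective_id⟩

/-- The free module of rank `n` over `O / 𝔪 ^ k`, regarded as an `O`-module. -/
abbrev Ambient (n k : ℕ) : Type _ := Fin n → O ⧸ (maximalIdeal O ^ k)

variable {O}

/-- The submodule `x` is of type `p`. -/
def HasType {n m k : ℕ} (x : Submodule O (Ambient O n k)) (p : ModType m k) : Prop :=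
  Nonempty (x ≃ₗ[O] StdModule O p)

variable (O)

/-- The Grassmannian `X_p` of submodules of type `p`. -/
abbrev Gr (n : ℕ) {m k : ℕ} (p : ModType m k) : Type _ :=
  {x : Submodule O (Ambient O n k) // HasType x p}

/-- The space of complex valued functions on `X_p`. -/
abbrev Fun (n : ℕ) {m k : ℕ} (p : ModType m k) : Type _ := Gr O n p → ℂ

variable {O}

/-- The automorphism `g` of the ambient module moves `x` to `g x`. -/
def translate {n m k : ℕ} {p : ModType m k} (g : Ambient O n k ≃ₗ[O] Ambient O n k)
    (x : Gr O n p) : Gr O n p :=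
  ⟨x.1.map (g : Ambient O n k →ₗ[O] Ambient O n k),
    x.2.elim fun e => ⟨(g.submoduleMap x.1).symm.trans e⟩⟩

/-- The representation of the automorphism group on functions, `(g h)(x) = h (g⁻¹ x)`. -/
def act {n m k : ℕ} (p : ModType m k) (g : Ambient O n k ≃ₗ[O] Ambient O n k) :
    Fun O n p →ₗ[ℂ] Fun O n p :=
  LinearMap.funLeft ℂ ℂ (translate g.symm)

/-- Linear maps commuting with the action of the automorphism group. -/
def IsEquivariant {n m k : ℕ} {p q : ModType m k} (S : Fun O n p →ₗ[ℂ] Fun O n q) : Prop :=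
  ∀ g : Ambient O n k ≃ₗ[O] Ambient O n k, S ∘ₗ act p g = act q g ∘ₗ S

variable (O)

/-- The Hecke algebra: the endomorphisms of the functions on `X_(k ^ m)` that commute with the
automorphism group of the free module of rank `n`. -/
def Hecke (n m k : ℕ) : Subalgebra ℂ (Module.End ℂ (Fun O n (rect m k))) :=
  Subalgebra.centralizer ℂ
    (Set.range fun g : Ambient O n k ≃ₗ[O] Ambient O n k =>
      (act (rect m k) g : Module.End ℂ (Fun O n (rect m k))))

end Modules

section Counting

variable {O : Type*} [CommRing O] [IsLocalRing O]

/-- The number of submodules of type `p` lying between `x` and `z`. -/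
def betweenCount {n m k : ℕ} (p : ModType m k) (x z : Submodule O (Ambient O n k)) : ℕ :=
  Set.ncard {y : Submodule O (Ambient O n k) | HasType y p ∧ x ≤ y ∧ y ≤ z}

/-- The number of submodules of type `p` that contain `x` and are transversal to `w`. -/
def avoidCount {n m k : ℕ} (p : ModType m k) (x w : Submodule O (Ambient O n k)) : ℕ :=
  Set.ncard {z : Submodule O (Ambient O n k) | HasType z p ∧ x ≤ z ∧ z ⊓ w = ⊥}

/-- `x ⊆ z` are submodules of types `p` and `q`. -/
def IsNested {n m k : ℕ} (p q : ModType m k) (x z : Submodule O (Ambient O n k)) : Prop :=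
  HasType x p ∧ HasType z q ∧ x ≤ z

/-- `x` and `w` are transversal submodules of types `p` and `q`. -/
def IsTransversal {n m k : ℕ} (p q : ModType m k) (x w : Submodule O (Ambient O n k)) : Prop :=
  HasType x p ∧ HasType w q ∧ x ⊓ w = ⊥

variable (O)

open Classical in
/-- `[p ≺ q̇ ≺ r]`: the number of modules of type `q` between fixed modules of types `p`
and `r` (zero if there are no such modules). -/
def between (n : ℕ) {m k : ℕ} (p q r : ModType m k) : ℕ :=
  if h : ∃ a : Submodule O (Ambient O n k) × Submodule O (Ambient O n k),
      IsNested p r a.1 a.2 then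
    betweenCount q h.choose.1 h.choose.2
  else 0

open Classical in
/-- `[p ≺ q̇ ⋔ r]`: the number of modules of type `q` that contain a fixed module of type `p`
and are transversal to a fixed module of type `r`, the two fixed modules being transversal
(zero if there are no such modules). -/
def avoid (n : ℕ) {m k : ℕ} (p q r : ModType m k) : ℕ :=
  if h : ∃ a : Submodule O (Ambient O n k) × Submodule O (Ambient O n k),
      IsTransversal p r a.1 a.2 then
    avoidCount q h.choose.1 h.choose.2
  else 0

end Counting

section Operators

variable (O : Type*) [CommRing O] [IsDomain O] [IsDiscreteValuationRing O]
  [Finite (ResidueField O)]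

instance finite_quotient (k : ℕ) : Finite (O ⧸ (maximalIdeal O ^ k)) :=
  haveI : Finite (O ⧸ maximalIdeal O) := ‹Finite (ResidueField O)›
  Ideal.finite_quotient_pow (IsNoetherian.noetherian (maximalIdeal O)) k

instance finite_submodule (n k : ℕ) : Finite (Submodule O (Ambient O n k)) :=
  Finite.of_injective (fun x => (x : Set (Ambient O n k))) SetLike.coe_injective

instance fintypeGr (n : ℕ) {m k : ℕ} (p : ModType m k) : Fintype (Gr O n p) :=
  Fintype.ofFinite _

open Classical in
/-- The operator from functions on `X_p` to functions on `X_q` that sends `h` to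
`y ↦ ∑_{x ⊆ y} h x`. -/
def up (n : ℕ) {m k : ℕ} (p q : ModType m k) : Fun O n p →ₗ[ℂ] Fun O n q where
  toFun h := fun y => ∑ x : Gr O n p with x.1 ≤ y.1, h x
  map_add' h h' := by
    funext y
    simp [Finset.sum_add_distrib]
  map_smul' c h := by
    funext y
    simp [Finset.mul_sum]

open Classical in
/-- The operator from functions on `X_q` to functions on `X_p` that sends `h` to
`x ↦ ∑_{y ⊇ x} h y`. -/
def down (n : ℕ) {m k : ℕ} (q p : ModType m k) : Fun O n q →ₗ[ℂ] Fun O n p where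
  toFun h := fun x => ∑ y : Gr O n q with x.1 ≤ y.1, h y
  map_add' h h' := by
    funext y
    simp [Finset.sum_add_distrib]
  map_smul' c h := by
    funext y
    simp [Finset.mul_sum]

variable {O}

theorem translate_le_iff {n m k : ℕ} {p q : ModType m k}
    (g : Ambient O n k ≃ₗ[O] Ambient O n k) (x : Gr O n p) (y : Gr O n q) :
    (translate g x).1 ≤ (translate g y).1 ↔ x.1 ≤ y.1 :=
  Submodule.map_le_map_iff_of_injective g.injective x.1 y.1

theorem translate_symm_translate {n m k : ℕ} {p : ModType m k}
    (g : Ambient O n k ≃ₗ[O] Ambient O n k) (x : Gr O n p) :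
    translate g.symm (translate g x) = x := by
  apply Subtype.ext
  simp [translate, ← Submodule.map_comp]

theorem translate_translate_symm {n m k : ℕ} {p : ModType m k}
    (g : Ambient O n k ≃ₗ[O] Ambient O n k) (x : Gr O n p) :
    translate g (translate g.symm x) = x := by
  apply Subtype.ext
  simp [translate, ← Submodule.map_comp]

/-- The permutation of `X_p` given by an automorphism. -/
def translateEquiv {n m k : ℕ} {p : ModType m k} (g : Ambient O n k ≃ₗ[O] Ambient O n k) :
    Gr O n p ≃ Gr O n p where
  toFun := translate g
  invFun := translate g.symm
  left_inv := translate_symm_translate g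
  right_inv := translate_translate_symm g

theorem up_equivariant {n m k : ℕ} (p q : ModType m k) : IsEquivariant (up O n p q) := by
  classical
  intro g
  ext h y
  simp only [up, act, LinearMap.coe_comp, Function.comp_apply, LinearMap.funLeft_apply,
    LinearMap.coe_mk, AddHom.coe_mk, Finset.sum_filter]
  refine Fintype.sum_equiv (translateEquiv g.symm) _ _ fun x => ?_
  simp only [translateEquiv, Equiv.coe_fn_mk, translate_le_iff]

theorem down_equivariant {n m k : ℕ} (p q : ModType m k) : IsEquivariant (down O n q p) := by
  classical
  intro g
  ext h y
  simp only [down, act, LinearMap.coe_comp, Function.comp_apply, LinearMap.funLeft_apply,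
    LinearMap.coe_mk, AddHom.coe_mk, Finset.sum_filter]
  refine Fintype.sum_equiv (translateEquiv g.symm) _ _ fun x => ?_
  simp only [translateEquiv, Equiv.coe_fn_mk, translate_le_iff]

variable (O)

/-- The cellular basis element `c_p`: down from `k ^ m` to `p`, then up again. -/
def cell (n : ℕ) {m k : ℕ} (p : ModType m k) : Hecke O n m k :=
  ⟨up O n p (rect m k) ∘ₗ down O n (rect m k) p, by
    refine Subalgebra.mem_centralizer_iff ℂ |>.mpr ?_
    rintro _ ⟨g, rfl⟩
    change act (rect m k) g ∘ₗ (up O n p (rect m k) ∘ₗ down O n (rect m k) p) =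
      (up O n p (rect m k) ∘ₗ down O n (rect m k) p) ∘ₗ act (rect m k) g
    rw [LinearMap.comp_assoc, down_equivariant, ← LinearMap.comp_assoc, ← LinearMap.comp_assoc,
      up_equivariant]⟩

/-- The span of the `c_q` with `q ≤ p`. -/
def cellSpan (n : ℕ) {m k : ℕ} (p : ModType m k) : Submodule ℂ (Hecke O n m k) :=
  Submodule.span ℂ (cell O n '' {q | TypeLE O q p})

/-- The span of the `c_q` with `q < p`. -/
def cellSpanLT (n : ℕ) {m k : ℕ} (p : ModType m k) : Submodule ℂ (Hecke O n m k) :=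
  Submodule.span ℂ (cell O n '' {q | TypeLE O q p ∧ q ≠ p})

variable {O}

/-- `e` is the minimal idempotent belonging to the cell module
`K_p = cellSpan p / cellSpanLT p`: it acts as the identity on `K_p` and as zero on the other
cell modules. -/
structure IsCellIdempotent {n m k : ℕ} (e : Hecke O n m k) (p : ModType m k) : Prop where
  ne_zero : e ≠ 0
  idem : e * e = e
  minimal : ∀ f : Hecke O n m k, f * f = f → e * f = f → f * e = f → f = 0 ∨ f = e
  act_self : ∀ t ∈ cellSpan O n p, e * t - t ∈ cellSpanLT O n p
  act_other : ∀ q, q ≠ p → ∀ t ∈ cellSpan O n q, e * t ∈ cellSpanLT O n q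

/-- `S ↦ up ∘ S ∘ down`. With `F_p• = im (down (k ^ m) p)`, which is the orthogonal complement of
`ker (up p (k ^ m))`, two maps `S` have the same image here exactly when they induce the same map
`F_p• → F_q ⧸ ker (up q (k ^ m)) ≅ F_q•`. -/
def sandwich {n m k : ℕ} {p q : ModType m k} (S : Fun O n p →ₗ[ℂ] Fun O n q) :
    Module.End ℂ (Fun O n (rect m k)) :=
  up O n q (rect m k) ∘ₗ S ∘ₗ down O n (rect m k) p

variable (O)

/-- The index set of the family `Δ`: the common lower bounds of two types. -/
abbrev LowerBounds {m k : ℕ} (p q : ModType m k) : Type :=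
  {r : ModType m k // TypeLE O r p ∧ TypeLE O r q}

instance {m k : ℕ} (p q : ModType m k) : Fintype (LowerBounds O p q) := Fintype.ofFinite _

/-- The family `Δ` of maps `F_p → F_q`: down from `p` to `r`, then up from `r` to `q`. -/
def deltaMap (n : ℕ) {m k : ℕ} (p q : ModType m k) (r : LowerBounds O p q) :
    Fun O n p →ₗ[ℂ] Fun O n q :=
  up O n r.1 q ∘ₗ down O n p r.1

variable {O}

/-- The triple `p ≤ q ≤ s` is good: `Δ` induces a basis of the equivariant maps
`F_p• → F_q•`, and in the expansion of `down s q ∘ up p s` with respect to this basis the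
coefficient of the member `up p q` (the one with `r = p`) is `[q ≺ ṡ ⋔ p]`. -/
def IsGood (n : ℕ) {m k : ℕ} {p q : ModType m k} (hpq : TypeLE O p q) (s : ModType m k) : Prop :=
  LinearIndependent ℂ (fun r => sandwich (deltaMap O n p q r)) ∧
  (∀ S : Fun O n p →ₗ[ℂ] Fun O n q, IsEquivariant S →
    sandwich S ∈ Submodule.span ℂ (Set.range fun r => sandwich (deltaMap O n p q r))) ∧
  ∃ a : LowerBounds O p q → ℂ,
    sandwich (down O n s q ∘ₗ up O n p s) = ∑ r, a r • sandwich (deltaMap O n p q r) ∧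
    a ⟨p, TypeLE.refl O p, hpq⟩ = (avoid O n q s p : ℂ)

end Operators

end FiniteGrassmannian

end

/-!
Everything rests on one property of the free module `E` of rank `n` over `O ⧸ 𝔪 ^ k`: an injective
map from a submodule of `E` to `E` extends to an automorphism (`exists_equiv_extending`). Hence
configurations of submodules are conjugate as soon as they are abstractly isomorphic, two
automorphisms can be glued along the intersection of two submodules (`exists_glue`), and the counting
numbers are well defined. Since `2 * m ≤ n`, there is also room in `E` for the amalgam of any two
submodules `x`, `y` of types at most `k ^ m` along any common submodule (`exists_separates`).

Let `S : F_p → F_q` be equivariant with matrix `s x y`. The value `s x y` depends only on the amalgam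
of `x` and `y` along `x ⊓ y`, so `s` can also be evaluated at amalgams of `x` and `y` along smaller
submodules `u`. A Möbius transform in `u` writes `s x y` as a sum over `v ≤ x ⊓ y` of terms
`reduced s x y v`. Summing over `x ≤ z` and `y ≤ z'` turns the matrix of `up ∘ S ∘ down` into a sum
over `v ≤ z ⊓ z'` of numbers that depend only on the type of `v`, because `z` and `z'` are free. As
the matrix entry of `c_r` at `z`, `z'` is the number of submodules of type `r` of `z ⊓ z'`, this
proves that `up ∘ S ∘ down` is a combination of the `c_r` with `r ≤ p` and `r ≤ q`
(`exists_sandwich_eq_sum`). It follows that the `c_r` span the Hecke algebra, that the cell spans are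
ideals, and that the family `Δ` spans; independence holds because every submodule of type at most
`k ^ m` is an intersection `z ⊓ z'`.

For `S = down ∘ up` the leading coefficient is computed in `reduced_down_up`. If `x ≤ y`, the amalgam
of `x` and `y` along `u ≤ x` is isomorphic to `y ⊕ x ⧸ u`. Finite modules over `O` are self-dual, so
there is an anti-isomorphism `D` from the submodules of `x` to those of a copy `x'` of `x`
transversal to `y`, with `D u ≃ x ⧸ u` (`exists_lattice_duality`). The number of `z` of type `k ^ m`
that contain the amalgam is therefore the number of `z ≥ y` with `z ⊓ x' ≥ D u`, and the Möbius
transform at `u = x` counts the `z ≥ y` with `z ⊓ x' = ⊥`. This gives the coefficient of `c_p`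
in `c_q * c_p`, which is the scalar by which `c_q` acts on the cell module of `p`. These scalars form
a triangular matrix with nonzero diagonal, so the characters of the cell modules identify the Hecke
algebra with the algebra of functions on the set of types, and the `e_p` are the dual basis
(`IsTriangular.dualBasis`).
-/

noncomputable section

universe u

namespace FiniteGrassmannian

open IsLocalRing

/-! ### Extending partial automorphisms of free modules -/

section Extension

variable {O : Type*} [CommRing O] [IsDomain O] [IsDiscreteValuationRing O]

theorem maximalIdeal_pow_eq_span {ϖ : O} (hϖ : Irreducible ϖ) (j : ℕ) :
    maximalIdeal O ^ j = Ideal.span {ϖ ^ j} := by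
  rw [hϖ.maximalIdeal_eq, Ideal.span_singleton_pow]

theorem mk_smul_eq_zero_iff {ϖ : O} (hϖ : Irreducible ϖ) (j : ℕ) (r : O) :
    (Ideal.Quotient.mk (maximalIdeal O ^ j) r) = 0 ↔ ϖ ^ j ∣ r := by
  rw [Ideal.Quotient.eq_zero_iff_mem, maximalIdeal_pow_eq_span hϖ, Ideal.mem_span_singleton]

theorem pow_smul_quotient_eq_zero {ϖ : O} (hϖ : Irreducible ϖ) {e k : ℕ} (hek : e ≤ k)
    (c : O ⧸ maximalIdeal O ^ e) : ϖ ^ k • c = 0 := by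
  obtain ⟨r, rfl⟩ := Ideal.Quotient.mk_surjective c
  rw [← Ideal.Quotient.mk_eq_mk, ← Submodule.Quotient.mk_smul, Ideal.Quotient.mk_eq_mk,
    mk_smul_eq_zero_iff hϖ]
  exact Dvd.dvd.mul_right (pow_dvd_pow _ hek) _

/-- In `O ⧸ 𝔪 ^ k` the annihilator of `ϖ ^ e` consists of multiples of `ϖ ^ (k - e)`. -/
theorem exists_eq_smul_of_pow_smul_eq_zero {ϖ : O} (hϖ : Irreducible ϖ) {e k : ℕ} (hek : e ≤ k)
    (c : O ⧸ maximalIdeal O ^ k) (hc : ϖ ^ e • c = 0) :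
    ∃ d : O ⧸ maximalIdeal O ^ k, c = ϖ ^ (k - e) • d := by
  obtain ⟨r, rfl⟩ := Ideal.Quotient.mk_surjective c
  rw [← Ideal.Quotient.mk_eq_mk, ← Submodule.Quotient.mk_smul, Ideal.Quotient.mk_eq_mk,
    mk_smul_eq_zero_iff hϖ] at hc
  obtain ⟨s, hs⟩ := hc
  refine ⟨Ideal.Quotient.mk _ s, ?_⟩
  have : r = ϖ ^ (k - e) * s := by
    have h0 : ϖ ^ e ≠ 0 := pow_ne_zero _ hϖ.ne_zero
    apply mul_left_cancel₀ h0
    rw [← mul_assoc, ← pow_add, Nat.add_sub_cancel' hek, ← hs, smul_eq_mul]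
  rw [this]
  rfl

theorem isUnit_or_exists_eq_mul {ϖ : O} (hϖ : Irreducible ϖ) (c : O) :
    IsUnit c ∨ ∃ d, c = d * ϖ := by
  by_cases h : IsUnit c
  · exact Or.inl h
  · right
    have : c ∈ maximalIdeal O := (mem_maximalIdeal c).2 h
    rw [hϖ.maximalIdeal_eq, Ideal.mem_span_singleton'] at this
    obtain ⟨d, hd⟩ := this
    exact ⟨d, hd.symm⟩

variable {n k : ℕ}

theorem pow_smul_ambient_eq_zero {ϖ : O} (hϖ : Irreducible ϖ) (a : Ambient O n k) :
    ϖ ^ k • a = 0 :=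
  funext fun _ => pow_smul_quotient_eq_zero hϖ le_rfl _

/-- In a free `O ⧸ 𝔪 ^ k`-module, the image under an `O`-linear map of a multiple `ϖ • y` is again
a multiple of `ϖ`, even if the map is not defined at `y`. -/
theorem exists_smul_eq_of_map_smul {ϖ : O} (hϖ : Irreducible ϖ) {x : Submodule O (Ambient O n k)}
    (f : x →ₗ[O] Ambient O n k) (y : Ambient O n k) (hy : ϖ • y ∈ x) :
    ∃ w, ϖ • w = f ⟨ϖ • y, hy⟩ := by
  rcases Nat.eq_zero_or_pos k with rfl | hk
  · have h0 : ∀ a : Ambient O n 0, a = 0 := fun a => by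
      simpa using pow_smul_ambient_eq_zero hϖ a
    exact ⟨0, by rw [h0 (f _), h0 (_ • _)]⟩
  · have h : ϖ ^ (k - 1) • f ⟨ϖ • y, hy⟩ = 0 := by
      rw [← map_smul]
      have : ϖ ^ (k - 1) • (⟨ϖ • y, hy⟩ : x) = 0 := by
        ext1
        simp only [Submodule.coe_smul, smul_smul, ← pow_succ, Nat.sub_add_cancel hk,
          ZeroMemClass.coe_zero]
        exact pow_smul_ambient_eq_zero hϖ y
      rw [this, map_zero]
    have h' : ∀ i, ∃ d : O ⧸ maximalIdeal O ^ k, f ⟨ϖ • y, hy⟩ i = ϖ • d := fun i => by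
      obtain ⟨d, hd⟩ := exists_eq_smul_of_pow_smul_eq_zero hϖ (Nat.sub_le k 1)
        (f ⟨ϖ • y, hy⟩ i) (congrFun h i)
      refine ⟨d, ?_⟩
      rw [hd, Nat.sub_sub_self hk, pow_one]
    choose d hd using h'
    exact ⟨d, funext fun i => (hd i).symm⟩

variable [Finite (ResidueField O)]

/-- One step of the extension of an injective map `f : x → E`: if `ϖ • y ∈ x` but `y ∉ x`, there
is an admissible value `z` at `y`. If all solutions of `ϖ • z = f (ϖ • y)` were values of `f`, then
`x` would contain the whole `ϖ`-torsion of `E` for reasons of cardinality, hence `y`. -/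
theorem exists_admissible_value {ϖ : O} (hϖ : Irreducible ϖ) {x : Submodule O (Ambient O n k)}
    (f : x →ₗ[O] Ambient O n k) (hf : Function.Injective f) (y : Ambient O n k) (hy : ϖ • y ∈ x)
    (hyx : y ∉ x) : ∃ z, ϖ • z = f ⟨ϖ • y, hy⟩ ∧ ∀ a : x, f a ≠ z := by
  classical
  by_contra! hcon
  obtain ⟨w, hw⟩ := exists_smul_eq_of_map_smul hϖ f y hy
  obtain ⟨x₁, hx₁⟩ := hcon w hw
  have hx₁y : ϖ • x₁ = ⟨ϖ • y, hy⟩ := hf (by rw [map_smul, hx₁, hw])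
  let A : Set (Ambient O n k) := {a | a ∈ x ∧ ϖ • a = 0}
  let B : Set (Ambient O n k) := {a | ϖ • a = 0}
  have hBA : ∀ b ∈ B, ∃ a : x, f a = b ∧ ϖ • (a : Ambient O n k) = 0 := by
    intro b hb
    obtain ⟨a, ha⟩ := hcon (w + b) (by rw [smul_add, hw, show ϖ • b = 0 from hb, add_zero])
    refine ⟨a - x₁, by rw [map_sub, ha, hx₁]; abel, ?_⟩
    have : ϖ • (a - x₁) = 0 := hf (by
      rw [map_smul, map_sub, ha, hx₁, map_zero, add_sub_cancel_left]; exact hb)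
    simpa using congrArg Subtype.val this
  have hcard : B.ncard ≤ A.ncard := by
    choose g hg hg' using hBA
    refine Set.ncard_le_ncard_of_injOn (fun b => if h : b ∈ B then (g b h : Ambient O n k) else 0)
      (fun b hb => ?_) (fun b hb b' hb' h => ?_) (Set.toFinite _)
    · simp only [dif_pos hb]
      exact ⟨(g b hb).2, hg' b hb⟩
    · simp only [dif_pos hb, dif_pos hb'] at h
      rw [← hg b hb, ← hg b' hb', Subtype.ext h]
  have hAB : A = B := Set.eq_of_subset_of_ncard_le (fun a ha => ha.2) hcard (Set.toFinite _)
  have hmem : y - x₁ ∈ A := by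
    rw [hAB]
    have := congrArg Subtype.val hx₁y
    simp only [Submodule.coe_smul] at this
    simp [B, smul_sub, this]
  exact hyx ((Submodule.sub_mem_iff_left x x₁.2).1 hmem.1)

/-- An injective map from a submodule of a finite free `O ⧸ 𝔪 ^ k`-module to the module itself
extends to an automorphism. -/
theorem exists_equiv_extending (x : Submodule O (Ambient O n k)) (f : x →ₗ[O] Ambient O n k)
    (hf : Function.Injective f) :
    ∃ g : Ambient O n k ≃ₗ[O] Ambient O n k, ∀ a : x, g a = f a := by
  obtain ⟨ϖ, hϖ⟩ := IsDiscreteValuationRing.exists_irreducible O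
  let T : Set (Submodule O (Ambient O n k)) :=
    {y | ∃ h : x ≤ y, ∃ f' : y →ₗ[O] Ambient O n k, Function.Injective f' ∧
      ∀ a : x, f' ⟨a, h a.2⟩ = f a}
  -- an injective extension of `f` with maximal domain `y` is defined everywhere
  obtain ⟨y, ⟨hxy, f', hf', hext⟩, hmax⟩ :=
    Set.Finite.exists_maximal (s := T) (Set.toFinite _) ⟨x, le_rfl, f, hf, fun _ => rfl⟩
  suffices hy : y = ⊤ by
    subst hy
    refine ⟨LinearEquiv.ofBijective (f' ∘ₗ Submodule.topEquiv.symm.toLinearMap)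
      (Finite.injective_iff_bijective.1
        (hf'.comp Submodule.topEquiv.symm.injective)), fun a => ?_⟩
    exact hext a
  by_contra hne
  obtain ⟨b₀, hb₀⟩ : ∃ b, b ∉ y := by
    by_contra! h
    exact hne (Submodule.eq_top_iff'.2 h)
  classical
  -- the last multiple `b` of `b₀` by a power of `ϖ` that is outside `y`
  have hex : ∃ j, ϖ ^ j • b₀ ∈ y := ⟨k, by rw [pow_smul_ambient_eq_zero hϖ]; exact y.zero_mem⟩
  obtain ⟨j, hj⟩ : ∃ j, Nat.find hex = j + 1 := Nat.exists_eq_succ_of_ne_zero fun h0 => by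
    have := Nat.find_spec hex
    rw [h0] at this
    exact hb₀ (by simpa using this)
  set b := ϖ ^ j • b₀ with hb
  have hby : b ∉ y := Nat.find_min hex (by omega)
  have hϖb : ϖ • b ∈ y := by
    have := Nat.find_spec hex
    rw [hj] at this
    rwa [hb, smul_smul, ← pow_succ']
  have hcb : ∀ c : O, c • b ∈ y → ∃ d, c = d * ϖ := fun c hc => by
    rcases isUnit_or_exists_eq_mul hϖ c with hu | h
    · exact absurd ((Submodule.smul_mem_iff_of_isUnit y hu).1 hc) hby
    · exact h
  obtain ⟨z, hz, hzf⟩ := exists_admissible_value hϖ f' hf' b hϖb hby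
  have hsmul : ∀ (d : O) (h : (d * ϖ) • b ∈ y), f' ⟨(d * ϖ) • b, h⟩ = (d * ϖ) • z := by
    intro d h
    rw [mul_smul d ϖ z, hz, ← map_smul]
    congr 1
    ext1
    simp [mul_smul]
  let P : Ambient O n k →ₗ.[O] Ambient O n k := ⟨y, f'⟩
  let Q : Ambient O n k →ₗ.[O] Ambient O n k := LinearPMap.mkSpanSingleton' b z fun c hc => by
    obtain ⟨d, rfl⟩ := hcb c (by rw [hc]; exact y.zero_mem)
    rw [RingHom.id_apply, ← hsmul d (by rw [hc]; exact y.zero_mem)]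
    have : (⟨(d * ϖ) • b, by rw [hc]; exact y.zero_mem⟩ : y) = 0 := Subtype.ext hc
    rw [this, map_zero]
  have hQ : ∀ (c : O) (h : c • b ∈ Q.domain), Q ⟨c • b, h⟩ = c • z :=
    fun c h => LinearPMap.mkSpanSingleton'_apply _ _ _ c h
  have hcompat : ∀ (u : P.domain) (v : Q.domain), (u : Ambient O n k) = v → P u = Q v := by
    rintro ⟨u, hu⟩ ⟨v, hv⟩ rfl
    obtain ⟨c, rfl⟩ := Submodule.mem_span_singleton.1 hv
    obtain ⟨d, rfl⟩ := hcb c hu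
    rw [hQ]
    exact hsmul d hu
  have hdom : ∀ a, a ∈ (P.sup Q hcompat).domain ↔ ∃ u ∈ y, ∃ c : O, u + c • b = a := by
    intro a
    rw [LinearPMap.domain_sup, Submodule.mem_sup]
    refine exists_congr fun u => and_congr Iff.rfl ⟨?_, ?_⟩
    · rintro ⟨v, hv, rfl⟩
      obtain ⟨c, rfl⟩ := Submodule.mem_span_singleton.1 hv
      exact ⟨c, rfl⟩
    · rintro ⟨c, rfl⟩
      exact ⟨_, Submodule.mem_span_singleton.2 ⟨c, rfl⟩, rfl⟩
  have hle : y ≤ (P.sup Q hcompat).domain := fun a ha => (hdom a).2 ⟨a, ha, 0, by simp⟩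
  have hT : (P.sup Q hcompat).domain ∈ T := by
    refine ⟨hxy.trans hle, (P.sup Q hcompat).toFun, ?_, fun a => ?_⟩
    · rw [← LinearMap.ker_eq_bot, LinearMap.ker_eq_bot']
      rintro ⟨a, ha⟩ ha0
      obtain ⟨u, hu, c, rfl⟩ := (hdom a).1 ha
      have hcQ : c • b ∈ Q.domain := Submodule.mem_span_singleton.2 ⟨c, rfl⟩
      have hval : (P.sup Q hcompat) ⟨u + c • b, ha⟩ = P ⟨u, hu⟩ + Q ⟨c • b, hcQ⟩ :=
        LinearPMap.sup_apply hcompat ⟨u, hu⟩ ⟨c • b, hcQ⟩ ⟨_, ha⟩ rfl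
      have ha0' : f' ⟨u, hu⟩ + c • z = 0 := by
        rw [← hQ c hcQ]
        exact hval.symm.trans ha0
      rcases isUnit_or_exists_eq_mul hϖ c with ⟨c, rfl⟩ | ⟨d, rfl⟩
      · refine absurd ?_ (hzf (-((c⁻¹ : Oˣ) : O) • ⟨u, hu⟩))
        rw [map_smul, eq_neg_of_add_eq_zero_left ha0', smul_neg, neg_smul, neg_neg, smul_smul,
          Units.inv_mul, one_smul]
      · have hdb : (d * ϖ) • b ∈ y := by
          rw [mul_smul]
          exact y.smul_mem d hϖb
        rw [← hsmul d hdb, ← map_add] at ha0'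
        have := hf' (ha0'.trans (map_zero f').symm)
        ext1
        simpa using congrArg Subtype.val this
    · rw [← hext a]
      have := LinearPMap.left_le_sup P Q hcompat
      exact (this.2 (x := ⟨a, hxy a.2⟩) (y := ⟨a, _⟩) rfl).symm
  have := hmax hT hle
  apply hby
  apply this
  exact (hdom b).2 ⟨0, y.zero_mem, 1, by simp⟩

/-- Two automorphisms that agree on `a ⊓ b` can be glued to one that agrees with the first on `a`
and with the second on `b`, provided that the images of `a` and `b` meet only where they must. -/
theorem exists_glue (a b : Submodule O (Ambient O n k))
    (γ δ : Ambient O n k ≃ₗ[O] Ambient O n k) (h : ∀ t ∈ a ⊓ b, γ t = δ t)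
    (hinf : ∀ s ∈ a, ∀ t ∈ b, γ s = δ t → s ∈ b) :
    ∃ ε : Ambient O n k ≃ₗ[O] Ambient O n k, (∀ s ∈ a, ε s = γ s) ∧ ∀ t ∈ b, ε t = δ t := by
  let P : Ambient O n k →ₗ.[O] Ambient O n k := ⟨a, γ.toLinearMap.domRestrict a⟩
  let Q : Ambient O n k →ₗ.[O] Ambient O n k := ⟨b, δ.toLinearMap.domRestrict b⟩
  have hcompat : ∀ (u : P.domain) (v : Q.domain), (u : Ambient O n k) = v → P u = Q v := by
    rintro ⟨u, hu⟩ ⟨v, hv⟩ rfl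
    exact h u ⟨hu, hv⟩
  have hval : ∀ (s t) (hs : s ∈ a) (ht : t ∈ b) (hst : s + t ∈ (P.sup Q hcompat).domain),
      (P.sup Q hcompat) ⟨s + t, hst⟩ = γ s + δ t := fun s t hs ht hst =>
    LinearPMap.sup_apply hcompat ⟨s, hs⟩ ⟨t, ht⟩ ⟨_, hst⟩ rfl
  have hinj : Function.Injective (P.sup Q hcompat).toFun := by
    rw [← LinearMap.ker_eq_bot, LinearMap.ker_eq_bot']
    rintro ⟨c, hc⟩ hc0
    obtain ⟨s, hs, t, ht, rfl⟩ := Submodule.mem_sup.1 hc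
    have h0 : γ s + δ t = 0 := (hval s t hs ht hc).symm.trans hc0
    have hsb : s ∈ b := hinf s hs (-t) (b.neg_mem ht) (by
      rw [map_neg]; exact eq_neg_of_add_eq_zero_left h0)
    rw [h s ⟨hs, hsb⟩, ← map_add] at h0
    exact Subtype.ext (δ.map_eq_zero_iff.1 h0)
  obtain ⟨g, hg⟩ := exists_equiv_extending _ _ hinj
  refine ⟨g, fun s hs => ?_, fun t ht => ?_⟩
  · have hs' : s + 0 ∈ (P.sup Q hcompat).domain := Submodule.mem_sup.2 ⟨s, hs, 0, b.zero_mem, rfl⟩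
    have := hg ⟨s + 0, hs'⟩
    rw [show (P.sup Q hcompat).toFun ⟨s + 0, hs'⟩ = γ s + δ 0 from hval s 0 hs b.zero_mem hs'] at this
    simpa using this
  · have ht' : 0 + t ∈ (P.sup Q hcompat).domain := Submodule.mem_sup.2 ⟨0, a.zero_mem, t, ht, rfl⟩
    have := hg ⟨0 + t, ht'⟩
    rw [show (P.sup Q hcompat).toFun ⟨0 + t, ht'⟩ = γ 0 + δ t from hval 0 t a.zero_mem ht ht'] at this
    simpa using this

/-- Isomorphic submodules of the ambient module are conjugate under its automorphism group, and
every isomorphism between them is induced by an automorphism. -/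
theorem exists_equiv_extending_equiv {x y : Submodule O (Ambient O n k)} (e : x ≃ₗ[O] y) :
    ∃ g : Ambient O n k ≃ₗ[O] Ambient O n k, (∀ a : x, g a = e a) ∧
      x.map (g : Ambient O n k →ₗ[O] Ambient O n k) = y := by
  obtain ⟨g, hg⟩ := exists_equiv_extending x (y.subtype ∘ₗ e.toLinearMap)
    (y.injective_subtype.comp e.injective)
  refine ⟨g, hg, le_antisymm ?_ fun b hb => ?_⟩
  · rintro _ ⟨a, ha, rfl⟩
    have := hg ⟨a, ha⟩
    change g a ∈ y
    rw [show g a = _ from this]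
    exact (e ⟨a, ha⟩).2
  · refine ⟨e.symm ⟨b, hb⟩, (e.symm ⟨b, hb⟩).2, ?_⟩
    exact (hg _).trans (by simp)

/-- An automorphism that maps part of a free submodule `z` into a free submodule `z'` of the same
rank agrees on that part with an automorphism that maps `z` onto `z'`. -/
theorem exists_equiv_map_rect {m : ℕ} {v z z' : Submodule O (Ambient O n k)}
    (hz : HasType z (rect m k)) (hz' : HasType z' (rect m k)) (hv : v ≤ z)
    (γ : Ambient O n k ≃ₗ[O] Ambient O n k) (hγ : ∀ a ∈ v, γ a ∈ z') :
    ∃ g : Ambient O n k ≃ₗ[O] Ambient O n k, (∀ a ∈ v, g a = γ a) ∧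
      z.map (g : Ambient O n k →ₗ[O] Ambient O n k) = z' := by
  obtain ⟨e⟩ := hz
  obtain ⟨e'⟩ := hz'
  change z ≃ₗ[O] Ambient O m k at e
  change z' ≃ₗ[O] Ambient O m k at e'
  let V : Submodule O (Ambient O m k) := v.comap (z.subtype ∘ₗ e.symm.toLinearMap)
  let f : V →ₗ[O] Ambient O m k := e'.toLinearMap ∘ₗ LinearMap.codRestrict z'
    (γ.toLinearMap ∘ₗ z.subtype ∘ₗ e.symm.toLinearMap ∘ₗ V.subtype) (fun c => hγ _ c.2)
  have hf : Function.Injective f := by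
    refine e'.injective.comp ?_
    intro c c' h
    have := congrArg Subtype.val h
    simp only [LinearMap.codRestrict_apply, LinearMap.comp_apply, LinearEquiv.coe_coe,
      Submodule.subtype_apply] at this
    exact Subtype.ext (e.symm.injective (Subtype.ext (γ.injective this)))
  obtain ⟨g₀, hg₀⟩ := exists_equiv_extending V f hf
  obtain ⟨g, hg, hgz⟩ := exists_equiv_extending_equiv ((e.trans g₀).trans e'.symm)
  refine ⟨g, fun a ha => ?_, hgz⟩
  have h1 := hg ⟨a, hv ha⟩
  have h2 := hg₀ ⟨e ⟨a, hv ha⟩, by simpa [V] using ha⟩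
  rw [h1]
  simp only [LinearEquiv.trans_apply]
  rw [h2]
  simp [f]

end Extension

/-! ### Finite modules over a discrete valuation ring: structure and duality -/

section Structure

variable {O : Type u} [CommRing O] [IsDomain O] [IsDiscreteValuationRing O]

/-- Multiplication by `ϖ ^ (k - e)` embeds `O ⧸ 𝔪 ^ e` in `O ⧸ 𝔪 ^ k`. -/
theorem exists_injective_quotient {ϖ : O} (hϖ : Irreducible ϖ) {e k : ℕ} (hek : e ≤ k) :
    ∃ f : (O ⧸ maximalIdeal O ^ e) →ₗ[O] (O ⧸ maximalIdeal O ^ k), Function.Injective f ∧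
      ∀ r : O, f (Ideal.Quotient.mk _ r) = ϖ ^ (k - e) • Ideal.Quotient.mk _ r := by
  let g : O →ₗ[O] (O ⧸ maximalIdeal O ^ k) :=
    ϖ ^ (k - e) • Submodule.mkQ (maximalIdeal O ^ k)
  have hg : ∀ r, g r = Ideal.Quotient.mk _ (ϖ ^ (k - e) * r) := fun r => rfl
  have hk : ∀ r, g r = 0 ↔ r ∈ maximalIdeal O ^ e := fun r => by
    rw [hg, mk_smul_eq_zero_iff hϖ, maximalIdeal_pow_eq_span hϖ e, Ideal.mem_span_singleton]
    have : ϖ ^ k = ϖ ^ (k - e) * ϖ ^ e := by rw [← pow_add, Nat.sub_add_cancel hek]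
    rw [this]
    exact mul_dvd_mul_iff_left (pow_ne_zero _ hϖ.ne_zero)
  refine ⟨Submodule.liftQ (maximalIdeal O ^ e) g fun r hr => (hk r).2 hr, ?_, fun r => rfl⟩
  rw [← LinearMap.ker_eq_bot, LinearMap.ker_eq_bot']
  intro c hc
  obtain ⟨r, rfl⟩ := Ideal.Quotient.mk_surjective c
  exact Ideal.Quotient.eq_zero_iff_mem.2 ((hk r).1 hc)

/-- The cyclic module `O ⧸ 𝔪 ^ e` is self-dual with respect to `O ⧸ 𝔪 ^ k`. -/
theorem exists_cyclic_dual_equiv {e k : ℕ} (hek : e ≤ k) :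
    Nonempty (((O ⧸ maximalIdeal O ^ e) →ₗ[O] (O ⧸ maximalIdeal O ^ k)) ≃ₗ[O]
      (O ⧸ maximalIdeal O ^ e)) := by
  obtain ⟨ϖ, hϖ⟩ := IsDiscreteValuationRing.exists_irreducible O
  obtain ⟨f, hf, hfv⟩ := exists_injective_quotient hϖ hek
  let F : O →ₗ[O] ((O ⧸ maximalIdeal O ^ e) →ₗ[O] (O ⧸ maximalIdeal O ^ k)) :=
    LinearMap.toSpanSingleton O _ f
  have hsurj : Function.Surjective F := by
    intro g
    obtain ⟨d, hd⟩ := exists_eq_smul_of_pow_smul_eq_zero hϖ hek (g (Ideal.Quotient.mk _ 1)) (by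
      rw [← map_smul, pow_smul_quotient_eq_zero hϖ le_rfl, map_zero])
    obtain ⟨s, rfl⟩ := Ideal.Quotient.mk_surjective d
    refine ⟨s, LinearMap.ext fun c => ?_⟩
    obtain ⟨r, rfl⟩ := Ideal.Quotient.mk_surjective c
    have h1 : (Ideal.Quotient.mk (maximalIdeal O ^ e) r) =
        r • Ideal.Quotient.mk (maximalIdeal O ^ e) 1 := by
      rw [← Ideal.Quotient.mk_eq_mk, ← Ideal.Quotient.mk_eq_mk, ← Submodule.Quotient.mk_smul,
        smul_eq_mul, mul_one]
    have h2 : (Ideal.Quotient.mk (maximalIdeal O ^ k) s) =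
        s • Ideal.Quotient.mk (maximalIdeal O ^ k) 1 := by
      rw [← Ideal.Quotient.mk_eq_mk, ← Ideal.Quotient.mk_eq_mk, ← Submodule.Quotient.mk_smul,
        smul_eq_mul, mul_one]
    rw [h1, map_smul, map_smul, hd, h2]
    simp only [F, LinearMap.toSpanSingleton_apply, LinearMap.smul_apply, hfv]
    rw [smul_comm s]
  have hker : F.ker = maximalIdeal O ^ e := by
    ext r
    have h0 : F r = 0 ↔ f (Ideal.Quotient.mk _ r) = 0 := by
      constructor
      · intro h
        have := LinearMap.congr_fun h (Ideal.Quotient.mk _ 1)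
        simp only [F, LinearMap.toSpanSingleton_apply, LinearMap.smul_apply,
          LinearMap.zero_apply] at this
        rw [← map_smul, ← Ideal.Quotient.mk_eq_mk, ← Submodule.Quotient.mk_smul, smul_eq_mul,
          mul_one] at this
        exact this
      · intro h
        have h' := hf (h.trans (map_zero f).symm)
        refine LinearMap.ext fun c => ?_
        obtain ⟨s, rfl⟩ := Ideal.Quotient.mk_surjective c
        have : r • Ideal.Quotient.mk (maximalIdeal O ^ e) s = 0 := by
          have h1 : r • Ideal.Quotient.mk (maximalIdeal O ^ e) s =
            Ideal.Quotient.mk (maximalIdeal O ^ e) r * Ideal.Quotient.mk (maximalIdeal O ^ e) s :=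
            rfl
          rw [h1, h', zero_mul]
        simp only [F, LinearMap.toSpanSingleton_apply, LinearMap.smul_apply, LinearMap.zero_apply]
        rw [← map_smul, this, map_zero]
    rw [LinearMap.mem_ker, h0, ← Ideal.Quotient.eq_zero_iff_mem]
    exact ⟨fun h => hf (h.trans (map_zero f).symm), fun h => by rw [h, map_zero]⟩
  exact ⟨((Submodule.quotEquivOfEq _ _ hker.symm).trans
    (LinearMap.quotKerEquivOfSurjective F hsurj)).symm⟩

/-- A finite module killed by `𝔪 ^ k` is a product of modules `O ⧸ 𝔪 ^ e` with `e ≤ k`. -/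
theorem exists_equiv_pi {M : Type*} [AddCommGroup M] [Module O M] [Finite M] {ϖ : O}
    (hϖ : Irreducible ϖ) {k : ℕ} (hM : ∀ a : M, ϖ ^ k • a = 0) :
    ∃ (ι : Type u) (_ : Fintype ι) (e : ι → ℕ), (∀ i, e i ≤ k) ∧
      Nonempty (M ≃ₗ[O] ((i : ι) → O ⧸ maximalIdeal O ^ e i)) := by
  classical
  have htors : Module.IsTorsion O M := fun {a} =>
    ⟨⟨ϖ ^ k, mem_nonZeroDivisors_of_ne_zero (pow_ne_zero _ hϖ.ne_zero)⟩, hM a⟩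
  obtain ⟨ι, hι, p, hp, e, ⟨E⟩⟩ := Module.equiv_directSum_of_isTorsion htors
  have hpe : ∀ i, (O ∙ p i ^ e i) = maximalIdeal O ^ e i := fun i => by
    rw [maximalIdeal_pow_eq_span (hp i)]
  let E' : M ≃ₗ[O] ((i : ι) → O ⧸ maximalIdeal O ^ e i) :=
    (E.trans (DirectSum.linearEquivFunOnFintype O ι _)).trans
      (LinearEquiv.piCongrRight fun i => Submodule.quotEquivOfEq _ _ (hpe i))
  refine ⟨ι, hι, e, fun i => ?_, ⟨E'⟩⟩
  have h1 : ϖ ^ k • (fun i => Ideal.Quotient.mk (maximalIdeal O ^ e i) 1) = 0 := by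
    obtain ⟨a, ha⟩ := E'.surjective (fun i => Ideal.Quotient.mk (maximalIdeal O ^ e i) 1)
    rw [← ha, ← map_smul, hM, map_zero]
  have h2 : Ideal.Quotient.mk (maximalIdeal O ^ e i) (ϖ ^ k) = 0 := by
    have := congrFun h1 i
    simp only [Pi.smul_apply, Pi.zero_apply] at this
    rwa [← Ideal.Quotient.mk_eq_mk, ← Submodule.Quotient.mk_smul, smul_eq_mul, mul_one] at this
  rw [mk_smul_eq_zero_iff hϖ] at h2
  exact (pow_dvd_pow_iff hϖ.ne_zero hϖ.not_isUnit).1 h2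

variable {M : Type*} [AddCommGroup M] [Module O M] [Finite M] {ϖ : O} {k : ℕ}

theorem exists_dual_equiv (hϖ : Irreducible ϖ) (hM : ∀ a : M, ϖ ^ k • a = 0) :
    Nonempty ((M →ₗ[O] (O ⧸ maximalIdeal O ^ k)) ≃ₗ[O] M) := by
  classical
  obtain ⟨ι, _, e, he, ⟨E⟩⟩ := exists_equiv_pi hϖ hM
  exact ⟨((E.congrLeft (O ⧸ maximalIdeal O ^ k) O).trans
    (LinearMap.lsum O (fun i => O ⧸ maximalIdeal O ^ e i) O).symm).trans
    ((LinearEquiv.piCongrRight fun i => (exists_cyclic_dual_equiv (he i)).some).trans E.symm)⟩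

/-- The linear forms with values in `O ⧸ 𝔪 ^ k` separate the points of a module killed by
`𝔪 ^ k`. -/
theorem eq_zero_of_forall_dual (hϖ : Irreducible ϖ) (hM : ∀ a : M, ϖ ^ k • a = 0) (a : M)
    (ha : ∀ f : M →ₗ[O] (O ⧸ maximalIdeal O ^ k), f a = 0) : a = 0 := by
  obtain ⟨ι, _, e, he, ⟨E⟩⟩ := exists_equiv_pi hϖ hM
  apply E.injective
  rw [map_zero]
  funext i
  obtain ⟨f, hf, -⟩ := exists_injective_quotient hϖ (he i)
  apply hf
  rw [Pi.zero_apply, map_zero]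
  exact ha (f ∘ₗ LinearMap.proj i ∘ₗ E.toLinearMap)

/-- Isomorphic finite modules killed by `𝔪 ^ k` have anti-isomorphic lattices of submodules, in
such a way that the submodule corresponding to `u` is isomorphic to the quotient by `u`. -/
theorem exists_lattice_duality {N : Type*} [AddCommGroup N] [Module O N] (hϖ : Irreducible ϖ)
    (hM : ∀ a : M, ϖ ^ k • a = 0) (E : M ≃ₗ[O] N) :
    ∃ D : Submodule O M → Submodule O N, Function.Bijective D ∧
      (∀ u u', D u ≤ D u' ↔ u' ≤ u) ∧ ∀ u, Nonempty (D u ≃ₗ[O] (M ⧸ u)) := by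
  let A : Submodule O M → Submodule O (M →ₗ[O] (O ⧸ maximalIdeal O ^ k)) := fun u =>
    LinearMap.range (LinearMap.lcomp O (O ⧸ maximalIdeal O ^ k) u.mkQ)
  have hquot : ∀ (u : Submodule O M) (a : M ⧸ u), ϖ ^ k • a = 0 := fun u a => by
    obtain ⟨a, rfl⟩ := u.mkQ_surjective a
    rw [← map_smul, hM, map_zero]
  have hfin : ∀ u : Submodule O M, Finite (M ⧸ u) := fun u =>
    Finite.of_surjective _ u.mkQ_surjective
  have hmem : ∀ u f, f ∈ A u ↔ u ≤ LinearMap.ker f := by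
    intro u f
    constructor
    · rintro ⟨g, rfl⟩ a ha
      simp [(Submodule.Quotient.mk_eq_zero u).2 ha]
    · intro h
      exact ⟨u.liftQ f h, LinearMap.ext fun a => rfl⟩
  have hle : ∀ u u', A u ≤ A u' ↔ u' ≤ u := by
    intro u u'
    constructor
    · intro h a ha
      rw [← Submodule.Quotient.mk_eq_zero u]
      refine eq_zero_of_forall_dual hϖ (hquot u) _ fun f => ?_
      exact (hmem u' _).1 (h ⟨f, rfl⟩) ha
    · intro h f hf
      exact (hmem _ _).2 (h.trans ((hmem _ _).1 hf))
  have hequiv : ∀ u, Nonempty (A u ≃ₗ[O] (M ⧸ u)) := fun u => by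
    obtain ⟨e⟩ := exists_dual_equiv hϖ (hquot u)
    refine ⟨(LinearEquiv.ofInjective _ fun f g h => ?_).symm.trans e⟩
    refine LinearMap.ext fun a => ?_
    obtain ⟨a, rfl⟩ := u.mkQ_surjective a
    exact LinearMap.congr_fun h a
  obtain ⟨e⟩ := exists_dual_equiv hϖ hM
  have hAinj : Function.Injective A := fun u u' h =>
    le_antisymm ((hle _ _).1 h.ge) ((hle _ _).1 h.le)
  have : Finite (Submodule O M) := Finite.of_injective (fun x => (x : Set M)) SetLike.coe_injective
  refine ⟨fun u => (A u).map (e.trans E).toLinearMap, ?_, fun u u' => ?_, fun u => ?_⟩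
  · have hb : Function.Bijective fun u => Submodule.orderIsoMapComap e (A u) :=
      Finite.injective_iff_bijective.1 ((Submodule.orderIsoMapComap e).injective.comp hAinj)
    have := (Submodule.orderIsoMapComap E).bijective.comp hb
    convert this using 1
    funext u
    exact Submodule.map_comp _ _ _
  · exact (Submodule.map_le_map_iff_of_injective (e.trans E).injective _ _).trans (hle u u')
  · exact ⟨((e.trans E).submoduleMap (A u)).symm.trans (hequiv u).some⟩

/-- A quotient of a finite module is isomorphic to a submodule. -/
theorem exists_injective_of_quotient (hϖ : Irreducible ϖ) (hM : ∀ a : M, ϖ ^ k • a = 0)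
    (u : Submodule O M) : ∃ f : (M ⧸ u) →ₗ[O] M, Function.Injective f := by
  obtain ⟨D, -, -, hD⟩ := exists_lattice_duality hϖ hM (LinearEquiv.refl O M)
  obtain ⟨e⟩ := hD u
  exact ⟨(D u).subtype ∘ₗ e.symm.toLinearMap, (D u).injective_subtype.comp e.symm.injective⟩

end Structure

/-! ### Types of finite modules -/

section LocalRing

variable {O : Type*} [CommRing O] [IsLocalRing O]

theorem TypeLE.trans {m k : ℕ} {p q r : ModType m k} (h : TypeLE O p q) (h' : TypeLE O q r) :
    TypeLE O p r := by
  obtain ⟨f, hf⟩ := h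
  obtain ⟨g, hg⟩ := h'
  exact ⟨g ∘ₗ f, hg.comp hf⟩

theorem HasType.typeLE {n m k : ℕ} {p q : ModType m k} {x y : Submodule O (Ambient O n k)}
    (hx : HasType x p) (hy : HasType y q) (hxy : x ≤ y) : TypeLE O p q := by
  obtain ⟨e⟩ := hx
  obtain ⟨e'⟩ := hy
  exact ⟨e'.toLinearMap ∘ₗ Submodule.inclusion hxy ∘ₗ e.symm.toLinearMap,
    e'.injective.comp ((Submodule.inclusion_injective hxy).comp e.symm.injective)⟩

/-- Factors `O ⧸ 𝔪 ^ 0` of a product may be left out. -/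
theorem exists_equiv_pi_of_extend {ι κ : Type*} (j : ι ↪ κ) (e : ι → ℕ) (e' : κ → ℕ)
    (he : ∀ i, e' (j i) = e i) (h0 : ∀ t, t ∉ Set.range j → e' t = 0) :
    Nonempty (((t : κ) → O ⧸ maximalIdeal O ^ e' t) ≃ₗ[O]
      ((i : ι) → O ⧸ maximalIdeal O ^ e i)) := by
  classical
  obtain rfl : (fun i => e' (j i)) = e := funext he
  have hsub : ∀ t, t ∉ Set.range j → Subsingleton (O ⧸ maximalIdeal O ^ e' t) := fun t ht => by
    rw [h0 t ht, pow_zero, Ideal.one_eq_top]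
    exact Ideal.Quotient.subsingleton_iff.2 rfl
  refine ⟨LinearEquiv.ofBijective
    (LinearMap.pi fun i => LinearMap.proj (φ := fun t => O ⧸ maximalIdeal O ^ e' t) (j i))
    ⟨fun a b h => funext fun t => ?_, fun b => ?_⟩⟩
  · by_cases ht : t ∈ Set.range j
    · obtain ⟨i, rfl⟩ := ht
      exact congrFun h i
    · exact (hsub t ht).elim _ _
  · choose g hg using fun t (ht : t ∈ Set.range j) => ht
    refine ⟨fun t => if ht : t ∈ Set.range j then
      cast (by simp only [hg t ht]) (b (g t ht)) else 0, funext fun i => ?_⟩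
    have hi : j i ∈ Set.range j := ⟨i, rfl⟩
    simp only [LinearMap.pi_apply, LinearMap.proj_apply, dif_pos hi]
    exact eq_of_heq ((cast_heq _ _).trans (by rw [j.injective (hg _ hi)]))

/-- The elements of the socle of `M` that are multiples of `ϖ ^ j`. Over `O ⧸ 𝔪` they form a space
whose dimension is the number of parts `> j` of the type of `M`. -/
def socleLayer (ϖ : O) (M : Type*) [AddCommGroup M] [Module O M] (j : ℕ) : Set M :=
  {a | ϖ • a = 0 ∧ ∃ b, a = ϖ ^ j • b}

omit [IsLocalRing O] in
theorem ncard_socleLayer_le {ϖ : O} {M N : Type*} [AddCommGroup M] [Module O M] [AddCommGroup N]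
    [Module O N] [Finite N] (f : M →ₗ[O] N) (hf : Function.Injective f) (j : ℕ) :
    (socleLayer ϖ M j).ncard ≤ (socleLayer ϖ N j).ncard := by
  refine Set.ncard_le_ncard_of_injOn f ?_ hf.injOn (Set.toFinite _)
  rintro a ⟨ha, b, rfl⟩
  exact ⟨by rw [← map_smul, ha, map_zero], f b, map_smul f _ _⟩

end LocalRing

section Types

variable {O : Type*} [CommRing O] [IsDomain O] [IsDiscreteValuationRing O]

theorem ncard_socleLayer_quotient {ϖ : O} (hϖ : Irreducible ϖ) (e j : ℕ) :
    (socleLayer ϖ (O ⧸ maximalIdeal O ^ e) j).ncard =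
      if j < e then Nat.card (O ⧸ maximalIdeal O ^ 1) else 1 := by
  split_ifs with h
  · obtain ⟨f, hf, hfv⟩ := exists_injective_quotient hϖ (show 1 ≤ e by omega)
    have : socleLayer ϖ (O ⧸ maximalIdeal O ^ e) j = Set.range f := by
      ext a
      constructor
      · rintro ⟨ha, -⟩
        obtain ⟨d, hd⟩ := exists_eq_smul_of_pow_smul_eq_zero hϖ (show 1 ≤ e by omega) a
          (by rwa [pow_one])
        obtain ⟨r, rfl⟩ := Ideal.Quotient.mk_surjective d
        exact ⟨Ideal.Quotient.mk _ r, by rw [hfv, hd]⟩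
      · rintro ⟨c, rfl⟩
        refine ⟨by rw [← map_smul, ← pow_one ϖ, pow_smul_quotient_eq_zero hϖ le_rfl, map_zero], ?_⟩
        obtain ⟨r, rfl⟩ := Ideal.Quotient.mk_surjective c
        refine ⟨ϖ ^ (e - 1 - j) • Ideal.Quotient.mk _ r, ?_⟩
        rw [hfv, smul_smul, ← pow_add]
        congr 2
        omega
    rw [this, ← Set.image_univ, Set.ncard_image_of_injective _ hf, Set.ncard_univ]
  · rw [Set.ncard_eq_one]
    refine ⟨0, Set.ext fun a => ?_⟩
    rw [Set.mem_singleton_iff]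
    constructor
    · rintro ⟨-, b, rfl⟩
      exact pow_smul_quotient_eq_zero hϖ (by omega) b
    · rintro rfl
      exact ⟨smul_zero _, 0, (smul_zero _).symm⟩

theorem ncard_socleLayer_pi {ϖ : O} (hϖ : Irreducible ϖ) {ι : Type*} [Fintype ι] (e : ι → ℕ)
    (j : ℕ) :
    (socleLayer ϖ ((i : ι) → O ⧸ maximalIdeal O ^ e i) j).ncard =
      Nat.card (O ⧸ maximalIdeal O ^ 1) ^ (Finset.univ.filter fun i => j < e i).card := by
  have : socleLayer ϖ ((i : ι) → O ⧸ maximalIdeal O ^ e i) j =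
      Set.univ.pi fun i => socleLayer ϖ (O ⧸ maximalIdeal O ^ e i) j := by
    ext a
    simp only [socleLayer, Set.mem_ofPred_eq, Set.mem_univ_pi, forall_and, funext_iff,
      Pi.smul_apply, Pi.zero_apply]
    refine and_congr Iff.rfl ⟨fun ⟨b, hb⟩ i => ⟨b i, hb i⟩, fun h => ?_⟩
    choose b hb using h
    exact ⟨b, hb⟩
  rw [this, ← Nat.card_coe_set_eq, Nat.card_congr (Equiv.Set.univPi _), Nat.card_pi]
  simp only [Nat.card_coe_set_eq, ncard_socleLayer_quotient hϖ]
  rw [Finset.prod_ite, Finset.prod_const, Finset.prod_const_one, mul_one]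

variable [Finite (ResidueField O)]

theorem one_lt_card_quotient : 1 < Nat.card (O ⧸ maximalIdeal O ^ 1) := by
  have : Nontrivial (O ⧸ maximalIdeal O ^ 1) := by
    rw [pow_one]
    exact inferInstanceAs (Nontrivial (ResidueField O))
  exact Finite.one_lt_card

variable {m k : ℕ}

/-- Larger types have larger parts. -/
theorem TypeLE.part_le {p q : ModType m k} (h : TypeLE O p q) (i : Fin m) :
    p.part i ≤ q.part i := by
  obtain ⟨ϖ, hϖ⟩ := IsDiscreteValuationRing.exists_irreducible O
  obtain ⟨f, hf⟩ := h
  by_contra! hlt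
  have h1 := ncard_socleLayer_le (ϖ := ϖ) f hf (q.part i)
  rw [ncard_socleLayer_pi hϖ, ncard_socleLayer_pi hϖ,
    Nat.pow_le_pow_iff_right one_lt_card_quotient] at h1
  have h2 : Finset.Iic i ⊆ Finset.univ.filter fun i' => q.part i < p.part i' := fun i' hi' => by
    simp only [Finset.mem_filter, Finset.mem_univ, true_and]
    exact hlt.trans_le (p.antitone (Finset.mem_Iic.1 hi'))
  have h3 : (Finset.univ.filter fun i' => q.part i < q.part i') ⊆ Finset.Iio i := fun i' hi' => by
    simp only [Finset.mem_filter, Finset.mem_univ, true_and] at hi'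
    rw [Finset.mem_Iio]
    by_contra! hle
    exact absurd (q.antitone hle) (by omega)
  have h4 := Finset.card_le_card h2
  have h5 := Finset.card_le_card h3
  rw [Fin.card_Iic] at h4
  rw [Fin.card_Iio] at h5
  omega

theorem TypeLE.antisymm {p q : ModType m k} (h : TypeLE O p q) (h' : TypeLE O q p) : p = q :=
  ModType.ext (funext fun i => le_antisymm (h.part_le i) (h'.part_le i))

omit [Finite (ResidueField O)] in
theorem typeLE_rect (p : ModType m k) : TypeLE O p (rect m k) := by
  obtain ⟨ϖ, hϖ⟩ := IsDiscreteValuationRing.exists_irreducible O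
  choose f hf _ using fun i => exists_injective_quotient hϖ (p.le_height i)
  refine ⟨LinearMap.pi fun i => f i ∘ₗ LinearMap.proj i, fun a b h => funext fun i => ?_⟩
  exact hf i (congrFun h i)

theorem HasType.unique {n : ℕ} {p q : ModType m k} {x : Submodule O (Ambient O n k)}
    (hx : HasType x p) (hy : HasType x q) : p = q :=
  (hx.typeLE hy le_rfl).antisymm (hy.typeLE hx le_rfl)

/-- A finite module that embeds in a free `O ⧸ 𝔪 ^ k`-module of rank `m` has a type with at most
`m` parts. -/
theorem exists_equiv_stdModule {M : Type*} [AddCommGroup M] [Module O M] (f : M →ₗ[O] Ambient O m k)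
    (hf : Function.Injective f) : ∃ p : ModType m k, Nonempty (M ≃ₗ[O] StdModule O p) := by
  obtain ⟨ϖ, hϖ⟩ := IsDiscreteValuationRing.exists_irreducible O
  have : Finite M := Finite.of_injective f hf
  obtain ⟨ι, _, e, he, ⟨E⟩⟩ := exists_equiv_pi (M := M) hϖ (k := k) fun a => hf (by
    rw [map_smul, pow_smul_ambient_eq_zero hϖ, map_zero])
  let s := {i // 0 < e i}
  have hcard : Fintype.card s ≤ m := by
    have h1 := ncard_socleLayer_le (ϖ := ϖ) (f ∘ₗ E.symm.toLinearMap) (hf.comp E.symm.injective) 0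
    rw [ncard_socleLayer_pi hϖ, ncard_socleLayer_pi hϖ (fun _ : Fin m => k),
      Nat.pow_le_pow_iff_right one_lt_card_quotient] at h1
    rw [Fintype.card_subtype]
    refine h1.trans ((Finset.card_filter_le _ _).trans ?_)
    simp
  obtain ⟨g⟩ : Nonempty (s ↪ Fin m) :=
    Function.Embedding.nonempty_of_card_le (by rwa [Fintype.card_fin])
  let e' : Fin m → ℕ := Function.extend g (fun i => e i.1) 0
  have he' : ∀ i, e' (g i) = e i.1 := fun i => g.injective.extend_apply _ _ _
  have he0 : ∀ t, t ∉ Set.range g → e' t = 0 := fun t ht => by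
    simp only [e']
    rw [Function.extend_apply' _ _ _ ht]
    rfl
  obtain ⟨E₁⟩ := exists_equiv_pi_of_extend (O := O) (Function.Embedding.subtype fun i => 0 < e i)
    (fun i => e i.1) e (fun _ => rfl) (fun t ht => by
      by_contra h
      exact ht ⟨⟨t, Nat.pos_of_ne_zero h⟩, rfl⟩)
  obtain ⟨E₂⟩ := exists_equiv_pi_of_extend (O := O) g (fun i => e i.1) e' he' he0
  let σ := Tuple.sort fun t => OrderDual.toDual (e' t)
  obtain ⟨E₃⟩ := exists_equiv_pi_of_extend (O := O) σ.toEmbedding (fun t => e' (σ t)) e'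
    (fun _ => rfl) (fun t ht => absurd ⟨σ.symm t, by simp⟩ ht)
  refine ⟨⟨fun t => e' (σ t), fun t t' h => ?_, fun t => ?_⟩,
    ⟨(((E.trans E₁).trans E₂.symm).trans E₃)⟩⟩
  · exact Tuple.monotone_sort (fun t => OrderDual.toDual (e' t)) h
  · by_cases ht : σ t ∈ Set.range g
    · obtain ⟨i, hi⟩ := ht
      rw [← hi, he']
      exact he _
    · rw [he0 _ ht]
      exact Nat.zero_le _

theorem exists_hasType_of_le {n : ℕ} {p : ModType m k} {u x : Submodule O (Ambient O n k)}
    (hx : HasType x p) (hu : u ≤ x) : ∃ r : ModType m k, HasType u r := by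
  obtain ⟨e⟩ := hx
  obtain ⟨f, hf⟩ := typeLE_rect (O := O) p
  exact exists_equiv_stdModule (f ∘ₗ e.toLinearMap ∘ₗ Submodule.inclusion hu)
    (hf.comp (e.injective.comp (Submodule.inclusion_injective hu)))

end Types

/-! ### General position and the counting numbers -/

section LocalRing

variable {O : Type*} [CommRing O] [IsLocalRing O] {n m k : ℕ}

theorem hasType_range {p : ModType m k} {M : Type*} [AddCommGroup M] [Module O M]
    (e : M ≃ₗ[O] StdModule O p) (f : M →ₗ[O] Ambient O n k) (hf : Function.Injective f) :
    HasType (LinearMap.range f) p :=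
  ⟨(LinearEquiv.ofInjective f hf).symm.trans e⟩

theorem hasType_map_iff {p : ModType m k} (g : Ambient O n k ≃ₗ[O] Ambient O n k)
    (x : Submodule O (Ambient O n k)) :
    HasType (x.map (g : Ambient O n k →ₗ[O] Ambient O n k)) p ↔ HasType x p :=
  ⟨fun ⟨e⟩ => ⟨(g.submoduleMap x).trans e⟩, fun ⟨e⟩ => ⟨(g.submoduleMap x).symm.trans e⟩⟩

/-- Two independent coordinate submodules of rank `m`, with the projections to them. -/
theorem exists_coordinate_maps (hmn : 2 * m ≤ n) :
    ∃ (i₁ i₂ : Ambient O m k →ₗ[O] Ambient O n k) (p₁ p₂ : Ambient O n k →ₗ[O] Ambient O m k),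
      (∀ a, p₁ (i₁ a) = a) ∧ (∀ a, p₂ (i₂ a) = a) ∧ (∀ a, p₁ (i₂ a) = 0) ∧
        ∀ a, p₂ (i₁ a) = 0 := by
  let i₁ : Ambient O m k →ₗ[O] Ambient O n k := LinearMap.pi fun i =>
    if h : i.1 < m then LinearMap.proj ⟨i.1, h⟩ else 0
  let i₂ : Ambient O m k →ₗ[O] Ambient O n k := LinearMap.pi fun i =>
    if h : m ≤ i.1 ∧ i.1 - m < m then LinearMap.proj ⟨i.1 - m, h.2⟩ else 0
  refine ⟨i₁, i₂, LinearMap.pi fun i => LinearMap.proj ⟨i.1, by omega⟩,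
    LinearMap.pi fun i => LinearMap.proj ⟨i.1 + m, by omega⟩, fun a => funext fun i => ?_,
    fun a => funext fun i => ?_, fun a => funext fun i => ?_, fun a => funext fun i => ?_⟩
  · simp [i₁]
  · simp [i₂]
  · have : ¬ (m ≤ i.1 ∧ i.1 - m < m) := by omega
    simp only [LinearMap.pi_apply, i₂, dif_neg this, LinearMap.proj_apply, LinearMap.zero_apply,
      Pi.zero_apply]
  · simp [i₁]

theorem map_eq_map_of_agree {x : Submodule O (Ambient O n k)}
    {g h : Ambient O n k ≃ₗ[O] Ambient O n k} (hgh : ∀ a ∈ x, g a = h a) :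
    x.map (g : Ambient O n k →ₗ[O] Ambient O n k) =
      x.map (h : Ambient O n k →ₗ[O] Ambient O n k) := by
  ext b
  simp only [Submodule.mem_map, LinearEquiv.coe_coe]
  exact exists_congr fun a => and_congr_right fun ha => by rw [hgh a ha]

theorem translate_congr {p : ModType m k} {x : Gr O n p}
    {g h : Ambient O n k ≃ₗ[O] Ambient O n k} (hgh : ∀ a ∈ x.1, g a = h a) :
    translate g x = translate h x :=
  Subtype.ext (map_eq_map_of_agree hgh)

theorem translate_trans {p : ModType m k} (x : Gr O n p)
    (g h : Ambient O n k ≃ₗ[O] Ambient O n k) :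
    translate (g.trans h) x = translate h (translate g x) :=
  Subtype.ext (Submodule.map_comp _ _ _)

theorem translate_refl {p : ModType m k} (x : Gr O n p) :
    translate (LinearEquiv.refl O (Ambient O n k)) x = x :=
  Subtype.ext (Submodule.map_id _)

theorem ncard_map_eq (g : Ambient O n k ≃ₗ[O] Ambient O n k)
    {P Q : Submodule O (Ambient O n k) → Prop}
    (h : ∀ y, P y ↔ Q (y.map (g : Ambient O n k →ₗ[O] Ambient O n k))) :
    Set.ncard {y | P y} = Set.ncard {y | Q y} := by
  rw [← Set.ncard_image_of_injective {y | P y} (Submodule.orderIsoMapComap g).injective]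
  congr 1
  ext y
  constructor
  · rintro ⟨y, hy, rfl⟩
    exact (h y).1 hy
  · intro hy
    obtain ⟨y, rfl⟩ := (Submodule.orderIsoMapComap g).surjective y
    exact ⟨y, (h y).2 hy, rfl⟩

theorem map_le_map_equiv_iff (g : Ambient O n k ≃ₗ[O] Ambient O n k)
    {x y : Submodule O (Ambient O n k)} :
    x.map (g : Ambient O n k →ₗ[O] Ambient O n k) ≤
      y.map (g : Ambient O n k →ₗ[O] Ambient O n k) ↔ x ≤ y :=
  Submodule.map_le_map_iff_of_injective g.injective x y

theorem map_inf_map_equiv (g : Ambient O n k ≃ₗ[O] Ambient O n k)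
    (x y : Submodule O (Ambient O n k)) :
    x.map (g : Ambient O n k →ₗ[O] Ambient O n k) ⊓
      y.map (g : Ambient O n k →ₗ[O] Ambient O n k) =
        (x ⊓ y).map (g : Ambient O n k →ₗ[O] Ambient O n k) :=
  (Submodule.map_inf _ g.injective).symm

theorem betweenCount_map (p : ModType m k) (g : Ambient O n k ≃ₗ[O] Ambient O n k)
    (x z : Submodule O (Ambient O n k)) :
    betweenCount p x z = betweenCount p (x.map (g : Ambient O n k →ₗ[O] Ambient O n k))
      (z.map (g : Ambient O n k →ₗ[O] Ambient O n k)) :=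
  ncard_map_eq g fun y => by
    rw [hasType_map_iff, map_le_map_equiv_iff, map_le_map_equiv_iff]

theorem avoidCount_map (p : ModType m k) (g : Ambient O n k ≃ₗ[O] Ambient O n k)
    (x w : Submodule O (Ambient O n k)) :
    avoidCount p x w = avoidCount p (x.map (g : Ambient O n k →ₗ[O] Ambient O n k))
      (w.map (g : Ambient O n k →ₗ[O] Ambient O n k)) :=
  ncard_map_eq g fun y => by
    rw [hasType_map_iff, map_le_map_equiv_iff, map_inf_map_equiv,
      Submodule.map_eq_bot_iff]

end LocalRing

section GeneralPosition

variable {O : Type*} [CommRing O] [IsDomain O] [IsDiscreteValuationRing O]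
  {n m k : ℕ}

theorem exists_injective_ambient (p : ModType m k) :
    ∃ f : StdModule O p →ₗ[O] Ambient O m k, Function.Injective f :=
  typeLE_rect p

/-- Submodules of given types in general position; the first one even lies in a submodule of
type `k ^ m` transversal to the second one. -/
theorem exists_general_position (hmn : 2 * m ≤ n) (p q : ModType m k) :
    ∃ x w z : Submodule O (Ambient O n k), HasType x p ∧ HasType w q ∧ HasType z (rect m k) ∧
      x ≤ z ∧ z ⊓ w = ⊥ := by
  obtain ⟨i₁, i₂, p₁, p₂, h₁, h₂, -, h₃⟩ := exists_coordinate_maps (O := O) (k := k) hmn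
  obtain ⟨f, hf⟩ := exists_injective_ambient (O := O) p
  obtain ⟨f', hf'⟩ := exists_injective_ambient (O := O) q
  have hi₁ : Function.Injective i₁ := Function.LeftInverse.injective h₁
  have hi₂ : Function.Injective i₂ := Function.LeftInverse.injective h₂
  refine ⟨LinearMap.range (i₁ ∘ₗ f), LinearMap.range (i₂ ∘ₗ f'), LinearMap.range i₁,
    hasType_range (LinearEquiv.refl _ _) _ (hi₁.comp hf),
    hasType_range (LinearEquiv.refl _ _) _ (hi₂.comp hf'),
    hasType_range (LinearEquiv.refl O (StdModule O (rect m k))) _ hi₁,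
    LinearMap.range_comp_le_range _ _, ?_⟩
  rw [eq_bot_iff]
  rintro _ ⟨⟨a, rfl⟩, b, hb⟩
  have h : f' b = 0 := by
    rw [← h₂ (f' b)]
    exact (congrArg p₂ hb).trans (h₃ a)
  rw [Submodule.mem_bot, ← hb, LinearMap.comp_apply, h, map_zero]

variable [Finite (ResidueField O)]

theorem HasType.exists_map {p : ModType m k} {x x' : Submodule O (Ambient O n k)}
    (hx : HasType x p) (hx' : HasType x' p) :
    ∃ g : Ambient O n k ≃ₗ[O] Ambient O n k,
      x.map (g : Ambient O n k →ₗ[O] Ambient O n k) = x' := by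
  obtain ⟨e⟩ := hx
  obtain ⟨e'⟩ := hx'
  obtain ⟨g, -, hg⟩ := exists_equiv_extending_equiv (e.trans e'.symm)
  exact ⟨g, hg⟩

/-- The automorphism `α` fixes `u` pointwise and moves `x` into general position with respect to
`y` relative to `u`: no point of `x` outside `u` is moved into `y`. If `u ≤ x ⊓ y`, then
`α x + y` is the amalgam of `x` and `y` along `u`. -/
def Separates (α : Ambient O n k ≃ₗ[O] Ambient O n k) (x y u : Submodule O (Ambient O n k)) :
    Prop :=
  (∀ a ∈ u, α a = a) ∧ ∀ a ∈ x, α a ∈ y → a ∈ u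

/-- For `2 * m ≤ n` there is room in the ambient module for all amalgams. After moving `y` into
the first coordinate submodule, send `a ∈ x` to the sum of the first component of `a` and of the
image of `a` under an embedding of `x ⧸ u` in the second coordinate submodule. -/
theorem exists_separates (hmn : 2 * m ≤ n) {p q : ModType m k}
    {x y u : Submodule O (Ambient O n k)} (hx : HasType x p) (hy : HasType y q) (hux : u ≤ x)
    (huy : u ≤ y) : ∃ α, Separates α x y u := by
  obtain ⟨ϖ, hϖ⟩ := IsDiscreteValuationRing.exists_irreducible O
  obtain ⟨i₁, i₂, p₁, p₂, h₁, h₂, -, h₃⟩ := exists_coordinate_maps (O := O) (k := k) hmn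
  obtain ⟨e⟩ := hx
  obtain ⟨e'⟩ := hy
  obtain ⟨f, hf⟩ := exists_injective_ambient (O := O) p
  obtain ⟨f', hf'⟩ := exists_injective_ambient (O := O) q
  have hi₁ : Function.Injective i₁ := Function.LeftInverse.injective h₁
  obtain ⟨g, hg⟩ := exists_equiv_extending y (i₁ ∘ₗ f' ∘ₗ e'.toLinearMap)
    (hi₁.comp (hf'.comp e'.injective))
  obtain ⟨j, hj⟩ := exists_injective_of_quotient (k := k) hϖ
    (fun a : x => Subtype.ext (pow_smul_ambient_eq_zero hϖ a.1)) (u.comap x.subtype)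
  let θ : x →ₗ[O] Ambient O m k :=
    f ∘ₗ e.toLinearMap ∘ₗ j ∘ₗ (u.comap x.subtype).mkQ
  have hθ : ∀ a : x, θ a = 0 ↔ (a : Ambient O n k) ∈ u := fun a => by
    have hinj : Function.Injective (f ∘ₗ e.toLinearMap ∘ₗ j) := hf.comp (e.injective.comp hj)
    have : θ a = (f ∘ₗ e.toLinearMap ∘ₗ j) ((u.comap x.subtype).mkQ a) := rfl
    rw [this, map_eq_zero_iff _ hinj, Submodule.mkQ_apply, Submodule.Quotient.mk_eq_zero]
    rfl
  let F : x →ₗ[O] Ambient O n k :=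
    g.symm.toLinearMap ∘ₗ (i₁ ∘ₗ p₁ ∘ₗ g.toLinearMap ∘ₗ x.subtype + i₂ ∘ₗ θ)
  have hF : ∀ a : x, g (F a) = i₁ (p₁ (g a)) + i₂ (θ a) := fun a => by simp [F]
  have hFu : ∀ a : x, (a : Ambient O n k) ∈ u → F a = a := fun a ha => by
    apply g.injective
    rw [hF, (hθ a).2 ha, map_zero, add_zero, hg ⟨a, huy ha⟩]
    simp [h₁]
  have hFy : ∀ a : x, F a ∈ y → (a : Ambient O n k) ∈ u := fun a ha => by
    have h := hg ⟨F a, ha⟩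
    rw [hF] at h
    have h' := congrArg p₂ h
    rw [map_add, h₃, zero_add, h₂] at h'
    exact (hθ a).1 (h'.trans (h₃ _))
  have hinj : Function.Injective F := by
    rw [← LinearMap.ker_eq_bot, LinearMap.ker_eq_bot']
    intro a ha
    have hau := hFy a (by rw [ha]; exact y.zero_mem)
    rw [hFu a hau] at ha
    exact Subtype.ext ha
  obtain ⟨α, hα⟩ := exists_equiv_extending x F hinj
  exact ⟨α, fun a ha => by rw [hα ⟨a, hux ha⟩, hFu ⟨a, hux ha⟩ ha],
    fun a ha hay => hFy ⟨a, ha⟩ (by rw [← hα ⟨a, ha⟩]; exact hay)⟩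

theorem exists_glue_of_disjoint {x w x' w' : Submodule O (Ambient O n k)}
    (hxw : x ⊓ w = ⊥) (hxw' : x' ⊓ w' = ⊥) (γ δ : Ambient O n k ≃ₗ[O] Ambient O n k)
    (hγ : x.map (γ : Ambient O n k →ₗ[O] Ambient O n k) = x')
    (hδ : w.map (δ : Ambient O n k →ₗ[O] Ambient O n k) = w') :
    ∃ ε : Ambient O n k ≃ₗ[O] Ambient O n k, (∀ s ∈ x, ε s = γ s) ∧ ∀ t ∈ w, ε t = δ t := by
  refine exists_glue x w γ δ (fun t ht => ?_) fun s hs t ht hst => ?_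
  · rw [hxw, Submodule.mem_bot] at ht
    rw [ht, map_zero, map_zero]
  · have : γ s ∈ x' ⊓ w' :=
      ⟨hγ ▸ Submodule.mem_map_of_mem hs, hst ▸ hδ ▸ Submodule.mem_map_of_mem ht⟩
    rw [hxw', Submodule.mem_bot, γ.map_eq_zero_iff] at this
    rw [this]
    exact w.zero_mem

theorem betweenCount_eq_between {κ lam : ModType m k} {x z : Submodule O (Ambient O n k)}
    (h : IsNested κ (rect m k) x z) : betweenCount lam x z = between O n κ lam (rect m k) := by
  have hex : ∃ a : Submodule O (Ambient O n k) × Submodule O (Ambient O n k),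
      IsNested κ (rect m k) a.1 a.2 := ⟨(x, z), h⟩
  rw [between, dif_pos hex]
  obtain ⟨hx', hz', hxz'⟩ := hex.choose_spec
  obtain ⟨hx, hz, hxz⟩ := h
  obtain ⟨γ, hγ⟩ := hx.exists_map hx'
  obtain ⟨g, hg, hgz⟩ := exists_equiv_map_rect hz hz' hxz γ
    fun a ha => hxz' (hγ ▸ Submodule.mem_map_of_mem ha)
  rw [betweenCount_map lam g, hgz, map_eq_map_of_agree hg, hγ]

theorem avoidCount_eq_avoid {p q r : ModType m k} {x w : Submodule O (Ambient O n k)}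
    (h : IsTransversal p r x w) : avoidCount q x w = avoid O n p q r := by
  have hex : ∃ a : Submodule O (Ambient O n k) × Submodule O (Ambient O n k),
      IsTransversal p r a.1 a.2 := ⟨(x, w), h⟩
  rw [avoid, dif_pos hex]
  obtain ⟨hx', hw', hxw'⟩ := hex.choose_spec
  obtain ⟨hx, hw, hxw⟩ := h
  obtain ⟨γ, hγ⟩ := hx.exists_map hx'
  obtain ⟨δ, hδ⟩ := hw.exists_map hw'
  obtain ⟨ε, h₁, h₂⟩ := exists_glue_of_disjoint hxw hxw' γ δ hγ hδ
  rw [avoidCount_map q ε, map_eq_map_of_agree h₁, map_eq_map_of_agree h₂, hγ, hδ]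

omit [Finite (ResidueField O)] in
/-- Every chain of types `κ ≤ lam ≤ k ^ m` is realized by a chain of submodules. -/
theorem exists_chain (hmn : m ≤ n) {κ lam : ModType m k} (h : TypeLE O κ lam) :
    ∃ x y z : Submodule O (Ambient O n k), HasType x κ ∧ HasType y lam ∧
      HasType z (rect m k) ∧ x ≤ y ∧ y ≤ z := by
  obtain ⟨f, hf⟩ := h
  obtain ⟨f', hf'⟩ := exists_injective_ambient (O := O) lam
  let i : Ambient O m k →ₗ[O] Ambient O n k := LinearMap.pi fun i =>
    if h : i.1 < m then LinearMap.proj ⟨i.1, h⟩ else 0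
  have hi : Function.Injective i := fun a b hab => funext fun j => by
    have := congrFun hab ⟨j.1, by omega⟩
    simpa [i] using this
  refine ⟨LinearMap.range (i ∘ₗ f' ∘ₗ f), LinearMap.range (i ∘ₗ f'), LinearMap.range i,
    hasType_range (LinearEquiv.refl _ _) _ (hi.comp (hf'.comp hf)),
    hasType_range (LinearEquiv.refl _ _) _ (hi.comp hf'),
    hasType_range (LinearEquiv.refl O (StdModule O (rect m k))) _ hi, ?_, LinearMap.range_comp_le_range _ _⟩
  rw [← LinearMap.comp_assoc]
  exact LinearMap.range_comp_le_range _ _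

theorem between_pos (hmn : m ≤ n) {κ lam : ModType m k} (h : TypeLE O κ lam) :
    0 < between O n κ lam (rect m k) := by
  obtain ⟨x, y, z, hx, hy, hz, hxy, hyz⟩ := exists_chain hmn h
  rw [← betweenCount_eq_between (lam := lam) ⟨hx, hz, hxy.trans hyz⟩]
  exact (Set.ncard_pos (Set.toFinite _)).2 ⟨y, hy, hxy, hyz⟩

theorem avoid_pos (hmn : 2 * m ≤ n) (p q : ModType m k) :
    0 < avoid O n p (rect m k) q := by
  obtain ⟨x, w, z, hx, hw, hz, hxz, hzw⟩ := exists_general_position (O := O) hmn p q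
  rw [← avoidCount_eq_avoid (q := rect m k)
    ⟨hx, hw, eq_bot_iff.2 ((inf_le_inf_right w hxz).trans hzw.le)⟩]
  exact (Set.ncard_pos (Set.toFinite _)).2 ⟨z, hz, hxz, hzw⟩

/-- Nested submodules of the same type coincide. -/
theorem HasType.eq_of_le {p : ModType m k} {x y : Submodule O (Ambient O n k)} (hx : HasType x p)
    (hy : HasType y p) (h : x ≤ y) : x = y := by
  obtain ⟨e⟩ := hx
  obtain ⟨e'⟩ := hy
  apply SetLike.coe_injective
  refine Set.eq_of_subset_of_ncard_le h ?_ (Set.toFinite _)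
  rw [← Nat.card_coe_set_eq, ← Nat.card_coe_set_eq]
  exact (Nat.card_congr (e'.trans e.symm).toEquiv).le

theorem between_self (hmn : m ≤ n) (κ : ModType m k) :
    between O n κ κ (rect m k) = 1 := by
  obtain ⟨x, y, z, hx, hy, hz, hxy, hyz⟩ := exists_chain hmn (TypeLE.refl O κ)
  rw [← betweenCount_eq_between (lam := κ) ⟨hx, hz, hxy.trans hyz⟩, betweenCount,
    Set.ncard_eq_one]
  refine ⟨x, Set.ext fun y => ⟨fun ⟨h, hxy, _⟩ => (hx.eq_of_le h hxy).symm, ?_⟩⟩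
  rintro rfl
  exact ⟨hx, le_rfl, hxy.trans hyz⟩

end GeneralPosition

/-! ### Möbius transforms on finite posets -/

section Moebius

open scoped Classical

variable {α : Type*} [PartialOrder α] [Fintype α]

/-- The Möbius transform of `h`: the function whose sums over the lower intervals are the values
of `h`. -/
def moebiusTransform (h : α → ℂ) (a : α) : ℂ :=
  h a - ∑ b : {b // b < a}, moebiusTransform h b.1
termination_by wellFounded_lt.wrap a
decreasing_by exact b.2

theorem sum_moebiusTransform (h : α → ℂ) (a : α) :
    ∑ b with b ≤ a, moebiusTransform h b = h a := by
  have h1 : (Finset.univ.filter fun b => b ≤ a) = insert a (Finset.univ.filter fun b => b < a) := by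
    ext b
    simp [le_iff_eq_or_lt]
  rw [h1, Finset.sum_insert (by simp), moebiusTransform,
    ← Finset.sum_subtype (Finset.univ.filter fun b => b < a) (by simp) (moebiusTransform h)]
  ring

theorem eq_of_sum_le_eq {f g : α → ℂ} {a : α}
    (h : ∀ b ≤ a, ∑ c with c ≤ b, f c = ∑ c with c ≤ b, g c) : f a = g a := by
  induction a using WellFoundedLT.induction with
  | ind a ih =>
    have h1 : (Finset.univ.filter fun b => b ≤ a) =
        insert a (Finset.univ.filter fun b => b < a) := by
      ext b
      simp [le_iff_eq_or_lt]
    have h2 := h a le_rfl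
    rw [h1, Finset.sum_insert (by simp), Finset.sum_insert (by simp)] at h2
    have h3 : ∑ c with c < a, f c = ∑ c with c < a, g c :=
      Finset.sum_congr rfl fun c hc => by
        have hc' := (Finset.mem_filter.1 hc).2
        exact ih c hc' fun b hb => h b (hb.trans hc'.le)
    rw [h3] at h2
    exact add_right_cancel h2

/-- The Möbius transform is determined by its sums over the lower intervals. -/
theorem moebiusTransform_eq {h f : α → ℂ} {a : α}
    (hf : ∀ b ≤ a, ∑ c with c ≤ b, f c = h b) : moebiusTransform h a = f a :=
  eq_of_sum_le_eq fun b hb => by rw [sum_moebiusTransform, hf b hb]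

theorem moebiusTransform_orderIso (e : α ≃o α) {h h' : α → ℂ} {a : α}
    (hh : ∀ b ≤ a, h' (e b) = h b) : moebiusTransform h' (e a) = moebiusTransform h a := by
  refine (moebiusTransform_eq (f := fun c => moebiusTransform h' (e c)) fun b hb => ?_).symm
  rw [← hh b hb, ← sum_moebiusTransform h' (e b), Finset.sum_filter, Finset.sum_filter]
  refine Fintype.sum_equiv e.toEquiv _ _ fun c => ?_
  simp

end Moebius

/-! ### Amalgams and invariant kernels -/

section Kernels

open scoped Classical

variable {O : Type*} [CommRing O] [IsDomain O] [IsDiscreteValuationRing O]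
  [Finite (ResidueField O)] {n m k : ℕ}

instance fintypeSubmodule (n k : ℕ) : Fintype (Submodule O (Ambient O n k)) :=
  Fintype.ofFinite _

/-- A kernel on `X_p × X_q` that is constant on the orbits of the automorphism group. -/
def IsInvariant {p q : ModType m k} (s : Gr O n p → Gr O n q → ℂ) : Prop :=
  ∀ (g : Ambient O n k ≃ₗ[O] Ambient O n k) x y, s (translate g x) (translate g y) = s x y

/-- The value of an invariant kernel at a pair isomorphic to the amalgam of `x` and `y` along `u`,
a common submodule that may be smaller than `x ⊓ y`. -/
def amalgam {p q : ModType m k} (s : Gr O n p → Gr O n q → ℂ) (x : Gr O n p) (y : Gr O n q)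
    (u : Submodule O (Ambient O n k)) : ℂ :=
  if h : ∃ α, Separates α x.1 y.1 u then s (translate h.choose x) y else 0

variable {p q : ModType m k} {s : Gr O n p → Gr O n q → ℂ}

theorem amalgam_eq (hs : IsInvariant s) {x : Gr O n p} {y : Gr O n q}
    {u : Submodule O (Ambient O n k)} (huy : u ≤ y.1)
    {α : Ambient O n k ≃ₗ[O] Ambient O n k} (hα : Separates α x.1 y.1 u) :
    amalgam s x y u = s (translate α x) y := by
  have hex : ∃ α, Separates α x.1 y.1 u := ⟨α, hα⟩
  rw [amalgam, dif_pos hex]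
  set β := hex.choose
  obtain ⟨hβ₁, hβ₂⟩ : Separates β x.1 y.1 u := hex.choose_spec
  obtain ⟨ε, h₁, h₂⟩ := exists_glue (translate β x).1 y.1 (β.symm.trans α) (LinearEquiv.refl _ _)
    (by
      rintro _ ⟨⟨a, ha, rfl⟩, hb⟩
      have hau : a ∈ u := hβ₂ a ha hb
      change α (β.symm (β a)) = β a
      rw [LinearEquiv.symm_apply_apply, hα.1 a hau, hβ₁ a hau])
    (by
      rintro _ ⟨a, ha, rfl⟩ t ht h
      simp only [LinearEquiv.coe_coe, LinearEquiv.trans_apply, LinearEquiv.symm_apply_apply,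
        LinearEquiv.refl_apply] at h
      have hau : a ∈ u := hα.2 a ha (h ▸ ht)
      simpa [hβ₁ a hau] using huy hau)
  rw [← hs ε, ← translate_trans, translate_congr (g := ε) (h := LinearEquiv.refl _ _) h₂,
    translate_refl]
  congr 1
  refine translate_congr fun a ha => ?_
  exact (h₁ (β a) (Submodule.mem_map_of_mem ha)).trans (by simp)

theorem amalgam_inf (hs : IsInvariant s) (x : Gr O n p) (y : Gr O n q) :
    amalgam s x y (x.1 ⊓ y.1) = s x y := by
  rw [amalgam_eq hs inf_le_right (α := LinearEquiv.refl _ _)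
    ⟨fun _ _ => rfl, fun a ha hb => ⟨ha, hb⟩⟩, translate_refl]

theorem amalgam_translate (hmn : 2 * m ≤ n) (hs : IsInvariant s) {x : Gr O n p} {y : Gr O n q}
    {u : Submodule O (Ambient O n k)} (hux : u ≤ x.1) (huy : u ≤ y.1)
    {γ δ : Ambient O n k ≃ₗ[O] Ambient O n k} (h : ∀ a ∈ u, γ a = δ a) :
    amalgam s (translate γ x) (translate δ y)
      (u.map (γ : Ambient O n k →ₗ[O] Ambient O n k)) = amalgam s x y u := by
  obtain ⟨α, hα⟩ := exists_separates hmn x.2 y.2 hux huy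
  rw [amalgam_eq hs huy hα]
  have hα' : Separates ((γ.symm.trans α).trans δ) (translate γ x).1 (translate δ y).1
      (u.map (γ : Ambient O n k →ₗ[O] Ambient O n k)) := by
    constructor
    · rintro _ ⟨a, ha, rfl⟩
      change δ (α (γ.symm (γ a))) = γ a
      rw [LinearEquiv.symm_apply_apply, hα.1 a ha, h a ha]
    · rintro _ ⟨a, ha, rfl⟩ hb
      refine Submodule.mem_map_of_mem (hα.2 a ha ?_)
      obtain ⟨b, hb, hb'⟩ := hb
      simp only [LinearEquiv.coe_coe, LinearEquiv.trans_apply, LinearEquiv.symm_apply_apply,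
        EmbeddingLike.apply_eq_iff_eq] at hb'
      exact hb' ▸ hb
  rw [amalgam_eq hs (by rw [map_eq_map_of_agree h]; exact Submodule.map_mono huy) hα',
    ← hs δ (translate α x) y]
  rw [← translate_trans, ← translate_trans]
  congr 1
  refine translate_congr fun a _ => ?_
  simp

/-- The Möbius transform of an invariant kernel with respect to the submodule of amalgamation. -/
def reduced {p q : ModType m k} (s : Gr O n p → Gr O n q → ℂ) (x : Gr O n p) (y : Gr O n q)
    (v : Submodule O (Ambient O n k)) : ℂ :=
  moebiusTransform (amalgam s x y) v

theorem sum_reduced (hs : IsInvariant s) (x : Gr O n p) (y : Gr O n q) :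
    ∑ v with v ≤ x.1 ⊓ y.1, reduced s x y v = s x y := by
  rw [← amalgam_inf hs x y]
  exact sum_moebiusTransform _ _

theorem reduced_translate (hmn : 2 * m ≤ n) (hs : IsInvariant s) {x : Gr O n p} {y : Gr O n q}
    {v : Submodule O (Ambient O n k)} (hvx : v ≤ x.1) (hvy : v ≤ y.1)
    {γ δ : Ambient O n k ≃ₗ[O] Ambient O n k} (h : ∀ a ∈ v, γ a = δ a) :
    reduced s (translate γ x) (translate δ y)
      (v.map (γ : Ambient O n k →ₗ[O] Ambient O n k)) = reduced s x y v :=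
  moebiusTransform_orderIso (Submodule.orderIsoMapComap γ) fun _ hb =>
    amalgam_translate hmn hs (hb.trans hvx) (hb.trans hvy) fun a ha => h a (hb ha)

/-- The sum of the reduced kernel over all `x` between `v` and `z` and all `y` between `v`
and `z'`. -/
def coefficient {p q : ModType m k} (s : Gr O n p → Gr O n q → ℂ)
    (z z' v : Submodule O (Ambient O n k)) : ℂ :=
  ∑ x : Gr O n p with v ≤ x.1 ∧ x.1 ≤ z, ∑ y : Gr O n q with v ≤ y.1 ∧ y.1 ≤ z', reduced s x y v

theorem coefficient_map (hmn : 2 * m ≤ n) (hs : IsInvariant s)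
    (z z' v : Submodule O (Ambient O n k))
    {γ δ : Ambient O n k ≃ₗ[O] Ambient O n k} (h : ∀ a ∈ v, γ a = δ a) :
    coefficient s (z.map (γ : Ambient O n k →ₗ[O] Ambient O n k))
      (z'.map (δ : Ambient O n k →ₗ[O] Ambient O n k))
      (v.map (γ : Ambient O n k →ₗ[O] Ambient O n k)) = coefficient s z z' v := by
  symm
  simp only [coefficient, Finset.sum_filter]
  refine Fintype.sum_equiv (translateEquiv γ) _ _ fun x => ?_
  have h1 : (v.map (γ : Ambient O n k →ₗ[O] Ambient O n k) ≤ (translateEquiv γ x).1 ∧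
      (translateEquiv γ x).1 ≤ z.map (γ : Ambient O n k →ₗ[O] Ambient O n k)) ↔
      (v ≤ x.1 ∧ x.1 ≤ z) :=
    and_congr (map_le_map_equiv_iff γ) (map_le_map_equiv_iff γ)
  simp only [h1]
  split_ifs with hx
  · refine Fintype.sum_equiv (translateEquiv δ) _ _ fun y => ?_
    have h2 : (v.map (γ : Ambient O n k →ₗ[O] Ambient O n k) ≤ (translateEquiv δ y).1 ∧
        (translateEquiv δ y).1 ≤ z'.map (δ : Ambient O n k →ₗ[O] Ambient O n k)) ↔
        (v ≤ y.1 ∧ y.1 ≤ z') := by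
      rw [map_eq_map_of_agree h]
      exact and_congr (map_le_map_equiv_iff δ) (map_le_map_equiv_iff δ)
    simp only [h2]
    split_ifs with hy
    · exact (reduced_translate hmn hs hx.1 hy.1 h).symm
    · rfl
  · rfl

/-- The coefficient depends only on the type of `v`, since an isomorphism `v ≃ v'` extends to
isomorphisms of free modules of rank `m` containing `v` and `v'`. -/
theorem coefficient_eq (hmn : 2 * m ≤ n) (hs : IsInvariant s) {r : ModType m k}
    {z z' v z₁ z₁' v₁ : Submodule O (Ambient O n k)} (hz : HasType z (rect m k))
    (hz' : HasType z' (rect m k)) (hv : HasType v r) (hvz : v ≤ z) (hvz' : v ≤ z')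
    (hz₁ : HasType z₁ (rect m k)) (hz₁' : HasType z₁' (rect m k)) (hv₁ : HasType v₁ r)
    (hvz₁ : v₁ ≤ z₁) (hvz₁' : v₁ ≤ z₁') :
    coefficient s z z' v = coefficient s z₁ z₁' v₁ := by
  obtain ⟨g, hg⟩ := hv.exists_map hv₁
  obtain ⟨γ, hγ, hγz⟩ := exists_equiv_map_rect hz hz₁ hvz g
    fun a ha => hvz₁ (hg ▸ Submodule.mem_map_of_mem ha)
  obtain ⟨δ, hδ, hδz⟩ := exists_equiv_map_rect hz' hz₁' hvz' g
    fun a ha => hvz₁' (hg ▸ Submodule.mem_map_of_mem ha)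
  rw [← coefficient_map hmn hs z z' v (γ := γ) (δ := δ) fun a ha => by rw [hγ a ha, hδ a ha],
    hγz, hδz, map_eq_map_of_agree hγ, hg]

/-- Summing an invariant kernel over the pairs `x ≤ z`, `y ≤ z'` gives a combination of the numbers
of submodules of `z ⊓ z'` of the various types. -/
theorem sum_sum_eq_sum_coefficient (hs : IsInvariant s) (z z' : Submodule O (Ambient O n k)) :
    ∑ x : Gr O n p with x.1 ≤ z, ∑ y : Gr O n q with y.1 ≤ z', s x y =
      ∑ v with v ≤ z ⊓ z', coefficient s z z' v := by
  trans ∑ x : Gr O n p, ∑ y : Gr O n q, ∑ v,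
      if x.1 ≤ z ∧ y.1 ≤ z' ∧ v ≤ x.1 ∧ v ≤ y.1 then reduced s x y v else 0
  · simp only [← sum_reduced hs, Finset.sum_filter, le_inf_iff]
    refine Finset.sum_congr rfl fun x _ => ?_
    by_cases hx : x.1 ≤ z
    · simp only [hx, if_true, true_and]
      refine Finset.sum_congr rfl fun y _ => ?_
      by_cases hy : y.1 ≤ z' <;> simp [hy]
    · simp [hx]
  · rw [Finset.sum_congr rfl fun x _ => Finset.sum_comm, Finset.sum_comm]
    simp only [coefficient, Finset.sum_filter]
    refine Finset.sum_congr rfl fun v _ => ?_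
    split_ifs with hv
    · refine Finset.sum_congr rfl fun x _ => ?_
      split_ifs with hx
      · refine Finset.sum_congr rfl fun y _ => if_congr ?_ rfl rfl
        simp only [hx, true_and]
        exact and_comm
      · refine Finset.sum_eq_zero fun y _ => if_neg fun h => hx ⟨h.2.2.1, h.1⟩
    · refine Finset.sum_eq_zero fun x _ => Finset.sum_eq_zero fun y _ => if_neg fun h => hv ?_
      exact le_inf (h.2.2.1.trans h.1) (h.2.2.2.trans h.2.1)

end Kernels

/-! ### Expansion of sandwiched operators in the cellular elements -/

section Expansion

open scoped Classical

variable {O : Type*} [CommRing O] [IsDomain O] [IsDiscreteValuationRing O]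
  [Finite (ResidueField O)] {n m k : ℕ} {p q : ModType m k}

/-- The matrix of a linear map between function spaces. -/
def kernel (S : Fun O n p →ₗ[ℂ] Fun O n q) (x : Gr O n p) (y : Gr O n q) : ℂ :=
  S (Pi.single x 1) y

theorem ext_kernel {S T : Fun O n p →ₗ[ℂ] Fun O n q} (h : ∀ x y, kernel S x y = kernel T x y) :
    S = T :=
  (Pi.basisFun ℂ (Gr O n p)).ext fun x => by
    rw [Pi.basisFun_apply]
    exact funext (h x)

theorem act_single (g : Ambient O n k ≃ₗ[O] Ambient O n k) (x : Gr O n p) :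
    act p g (Pi.single x (1 : ℂ)) = Pi.single (translate g x) 1 := by
  funext y
  rw [act, LinearMap.funLeft_apply, Pi.single_apply, Pi.single_apply]
  refine if_congr ⟨?_, ?_⟩ rfl rfl
  · rintro rfl
    exact (translate_translate_symm g y).symm
  · rintro rfl
    exact translate_symm_translate g x

theorem isInvariant_kernel {S : Fun O n p →ₗ[ℂ] Fun O n q} (hS : IsEquivariant S) :
    IsInvariant (kernel S) := by
  intro g x y
  rw [kernel, ← act_single, ← LinearMap.comp_apply, hS g, LinearMap.comp_apply, act,
    LinearMap.funLeft_apply, translate_symm_translate]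
  rfl

omit [Finite (ResidueField O)] in
theorem IsEquivariant.comp {r : ModType m k} {S : Fun O n q →ₗ[ℂ] Fun O n r}
    {T : Fun O n p →ₗ[ℂ] Fun O n q} (hS : IsEquivariant S) (hT : IsEquivariant T) :
    IsEquivariant (S ∘ₗ T) := fun g => by
  rw [LinearMap.comp_assoc, hT g, ← LinearMap.comp_assoc, hS g, LinearMap.comp_assoc]

theorem up_apply (h : Fun O n p) (y : Gr O n q) :
    up O n p q h y = ∑ x : Gr O n p with x.1 ≤ y.1, h x := rfl

theorem down_apply (h : Fun O n q) (x : Gr O n p) :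
    down O n q p h x = ∑ y : Gr O n q with x.1 ≤ y.1, h y := rfl

theorem down_single (z : Gr O n q) :
    down O n q p (Pi.single z 1) = fun x => if x.1 ≤ z.1 then 1 else 0 := by
  funext x
  rw [down_apply, Finset.sum_filter, Finset.sum_eq_single z]
  · simp
  · intro y _ hy
    simp [hy]
  · simp

theorem up_single (x : Gr O n p) :
    up O n p q (Pi.single x 1) = fun y => if x.1 ≤ y.1 then 1 else 0 := by
  funext y
  rw [up_apply, Finset.sum_filter, Finset.sum_eq_single x]
  · simp
  · intro x' _ hx
    simp [hx]
  · simp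

theorem up_self : up O n p p = LinearMap.id := by
  refine ext_kernel fun x y => ?_
  rw [kernel, kernel, up_single, LinearMap.id_apply, Pi.single_apply]
  refine if_congr ⟨fun h => Subtype.ext (x.2.eq_of_le y.2 h).symm, ?_⟩ rfl rfl
  rintro rfl
  exact le_rfl

theorem down_self : down O n p p = LinearMap.id := by
  refine ext_kernel fun x y => ?_
  rw [kernel, kernel, down_single, LinearMap.id_apply, Pi.single_apply]
  refine if_congr ⟨fun h => Subtype.ext (y.2.eq_of_le x.2 h), ?_⟩ rfl rfl
  rintro rfl
  exact le_rfl

theorem kernel_sandwich (S : Fun O n p →ₗ[ℂ] Fun O n q) (z z' : Gr O n (rect m k)) :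
    kernel (sandwich S) z z' =
      ∑ x : Gr O n p with x.1 ≤ z.1, ∑ y : Gr O n q with y.1 ≤ z'.1, kernel S x y := by
  have h : down O n (rect m k) p (Pi.single z 1) =
      ∑ x : Gr O n p with x.1 ≤ z.1, Pi.single x (1 : ℂ) := by
    rw [down_single]
    funext x
    rw [Finset.sum_apply, Finset.sum_filter, Finset.sum_eq_single x]
    · simp
    · intro x' _ hx
      simp [hx.symm]
    · simp
  rw [kernel, sandwich, LinearMap.comp_apply, LinearMap.comp_apply, h, map_sum, map_sum,
    Finset.sum_apply]
  rfl

theorem sum_Gr_eq (f : Submodule O (Ambient O n k) → ℂ) :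
    ∑ x : Gr O n p, f x.1 = ∑ x with HasType x p, f x :=
  (Finset.sum_subtype _ (by simp) f).symm

/-- The kernel of a cellular element counts submodules of an intersection. -/
theorem kernel_cell (r : ModType m k) (z z' : Gr O n (rect m k)) :
    kernel (cell O n r : Module.End ℂ (Fun O n (rect m k))) z z' =
      ∑ v with v ≤ z.1 ⊓ z'.1, if HasType v r then 1 else 0 := by
  change up O n r (rect m k) (down O n (rect m k) r (Pi.single z 1)) z' = _
  rw [down_single, up_apply, Finset.sum_filter,
    sum_Gr_eq (fun x => if x ≤ z'.1 then if x ≤ z.1 then (1 : ℂ) else 0 else 0),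
    Finset.sum_filter, Finset.sum_filter]
  refine Finset.sum_congr rfl fun v _ => ?_
  simp only [le_inf_iff]
  split_ifs <;> tauto

theorem sum_hasType_smul (a : ModType m k → ℂ) {r : ModType m k}
    {v : Submodule O (Ambient O n k)} (hv : HasType v r) :
    ∑ t, a t * (if HasType v t then 1 else 0) = a r := by
  rw [Finset.sum_eq_single r]
  · simp [hv]
  · intro t _ ht
    rw [if_neg fun h => ht (h.unique hv), mul_zero]
  · simp

theorem kernel_sum_cell (a : ModType m k → ℂ) (z z' : Gr O n (rect m k)) :
    kernel (∑ r, a r • (cell O n r : Module.End ℂ (Fun O n (rect m k)))) z z' =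
      ∑ v with v ≤ z.1 ⊓ z'.1, ∑ r, a r * (if HasType v r then 1 else 0) := by
  have : kernel (∑ r, a r • (cell O n r : Module.End ℂ (Fun O n (rect m k)))) z z' =
      ∑ r, a r * kernel (cell O n r : Module.End ℂ (Fun O n (rect m k))) z z' := by
    simp [kernel, LinearMap.sum_apply]
  rw [this, Finset.sum_comm]
  refine Finset.sum_congr rfl fun r _ => ?_
  rw [kernel_cell, Finset.mul_sum]

/-- A sandwiched equivariant map `F_p → F_q` is a combination of the cellular elements `c_r` with
`r ≤ p` and `r ≤ q`, with coefficients given by the reduced kernel. -/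
theorem exists_sandwich_eq_sum (hmn : 2 * m ≤ n) {S : Fun O n p →ₗ[ℂ] Fun O n q}
    (hS : IsEquivariant S) :
    ∃ a : ModType m k → ℂ, (∀ r, ¬ (TypeLE O r p ∧ TypeLE O r q) → a r = 0) ∧
      (∀ r (z z' v : Submodule O (Ambient O n k)), HasType z (rect m k) → HasType z' (rect m k) →
        HasType v r → v ≤ z → v ≤ z' → coefficient (kernel S) z z' v = a r) ∧
      sandwich S = ∑ r, a r • (cell O n r : Module.End ℂ (Fun O n (rect m k))) := by
  have hs := isInvariant_kernel hS
  choose v _ z hv _ hz hvy hyz using fun r : ModType m k =>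
    exists_chain (O := O) (n := n) (by omega) (TypeLE.refl O r)
  have hvz := fun r => (hvy r).trans (hyz r)
  have ha : ∀ r (z₁ z₁' v₁ : Submodule O (Ambient O n k)), HasType z₁ (rect m k) →
      HasType z₁' (rect m k) → HasType v₁ r → v₁ ≤ z₁ → v₁ ≤ z₁' →
        coefficient (kernel S) z₁ z₁' v₁ = coefficient (kernel S) (z r) (z r) (v r) :=
    fun r z₁ z₁' v₁ h₁ h₂ h₃ h₄ h₅ =>
      coefficient_eq hmn hs h₁ h₂ h₃ h₄ h₅ (hz r) (hz r) (hv r) (hvz r) (hvz r)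
  refine ⟨fun r => coefficient (kernel S) (z r) (z r) (v r), fun r hr => ?_, ha,
    ext_kernel fun z₁ z₁' => ?_⟩
  · refine Finset.sum_eq_zero fun x hx => Finset.sum_eq_zero fun y hy => ?_
    exact absurd ⟨(hv r).typeLE x.2 (Finset.mem_filter.1 hx).2.1,
      (hv r).typeLE y.2 (Finset.mem_filter.1 hy).2.1⟩ hr
  · rw [kernel_sandwich, sum_sum_eq_sum_coefficient hs, kernel_sum_cell]
    refine Finset.sum_congr rfl fun w hw => ?_
    have hw' := (le_inf_iff.1 (Finset.mem_filter.1 hw).2)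
    obtain ⟨r, hr⟩ := exists_hasType_of_le z₁.2 hw'.1
    rw [sum_hasType_smul _ hr]
    exact ha r _ _ _ z₁.2 z₁'.2 hr hw'.1 hw'.2

/-! ### The cellular basis and its ideals -/

/-- The cellular elements are independent, because every submodule of type at most `k ^ m` is the
intersection of two submodules of type `k ^ m`. -/
theorem linearIndependent_cell_coe (hmn : 2 * m ≤ n) :
    LinearIndependent ℂ fun r : ModType m k =>
      (cell O n r : Module.End ℂ (Fun O n (rect m k))) := by
  rw [Fintype.linearIndependent_iff]
  intro a ha r
  obtain ⟨v, _, z, hv, _, hz, hvy, hyz⟩ :=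
    exists_chain (O := O) (n := n) (by omega) (TypeLE.refl O r)
  have hvz := hvy.trans hyz
  rw [← sum_hasType_smul a hv]
  refine eq_of_sum_le_eq (f := fun v => ∑ r, a r * (if HasType v r then 1 else 0))
    (g := fun _ => 0) fun b hb => ?_
  obtain ⟨α, hα₁, hα₂⟩ := exists_separates hmn hz hz (hb.trans hvz) (hb.trans hvz)
  have h : kernel (∑ r, a r • (cell O n r : Module.End ℂ (Fun O n (rect m k))))
      (translate α ⟨z, hz⟩) ⟨z, hz⟩ = 0 := by
    rw [ha]
    rfl
  rw [kernel_sum_cell] at h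
  have hinf : (translate α (⟨z, hz⟩ : Gr O n (rect m k))).1 ⊓ z = b := by
    apply le_antisymm
    · rintro _ ⟨⟨c, hc, rfl⟩, hcz⟩
      have := hα₂ c hc hcz
      simpa [hα₁ c this] using this
    · exact fun c hc => ⟨⟨c, hvz (hb hc), hα₁ c hc⟩, hvz (hb hc)⟩
  rw [hinf] at h
  simpa using h

theorem linearIndependent_cell (hmn : 2 * m ≤ n) :
    LinearIndependent ℂ fun r : ModType m k => cell O n r :=
  LinearIndependent.of_comp (Hecke O n m k).val.toLinearMap (linearIndependent_cell_coe hmn)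

omit [Finite (ResidueField O)] in
theorem isEquivariant_of_hecke (s : Hecke O n m k) :
    IsEquivariant (s : Module.End ℂ (Fun O n (rect m k))) := fun g =>
  ((Subalgebra.mem_centralizer_iff ℂ).1 s.2 _ ⟨g, rfl⟩).symm

theorem hecke_eq_sum {s : Hecke O n m k} {a : ModType m k → ℂ}
    (h : (s : Module.End ℂ (Fun O n (rect m k))) =
      ∑ r, a r • (cell O n r : Module.End ℂ (Fun O n (rect m k)))) :
    s = ∑ r, a r • cell O n r := by
  apply Subtype.ext
  rw [h]
  simp

theorem sum_smul_cell_mem_cellSpan {a : ModType m k → ℂ} {p : ModType m k}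
    (h : ∀ r, ¬ TypeLE O r p → a r = 0) : ∑ r, a r • cell O n r ∈ cellSpan O n p := by
  refine Submodule.sum_mem _ fun r _ => ?_
  by_cases hr : TypeLE O r p
  · exact Submodule.smul_mem _ _ (Submodule.subset_span ⟨r, hr, rfl⟩)
  · rw [h r hr, zero_smul]
    exact Submodule.zero_mem _

theorem sandwich_mul_cell (s : Hecke O n m k) (p : ModType m k) :
    ((s * cell O n p : Hecke O n m k) : Module.End ℂ (Fun O n (rect m k))) =
      sandwich ((s : Module.End ℂ (Fun O n (rect m k))) ∘ₗ up O n p (rect m k)) := by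
  rw [sandwich, up_self, LinearMap.id_comp]
  rfl

theorem sandwich_cell_mul (s : Hecke O n m k) (p : ModType m k) :
    ((cell O n p * s : Hecke O n m k) : Module.End ℂ (Fun O n (rect m k))) =
      sandwich (down O n (rect m k) p ∘ₗ (s : Module.End ℂ (Fun O n (rect m k)))) := by
  rw [sandwich, down_self, LinearMap.comp_id]
  rfl

theorem span_cell_eq_top (hmn : 2 * m ≤ n) :
    Submodule.span ℂ (Set.range fun r : ModType m k => cell O n r) = ⊤ := by
  rw [eq_top_iff]
  rintro s -
  obtain ⟨a, -, -, h⟩ := exists_sandwich_eq_sum hmn (isEquivariant_of_hecke s)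
  rw [sandwich, up_self, down_self, LinearMap.comp_id, LinearMap.id_comp] at h
  rw [hecke_eq_sum h]
  exact Submodule.sum_mem _ fun r _ => Submodule.smul_mem _ _ (Submodule.subset_span ⟨r, rfl⟩)

theorem mul_cell_mem (hmn : 2 * m ≤ n) (s : Hecke O n m k) (p : ModType m k) :
    s * cell O n p ∈ cellSpan O n p := by
  obtain ⟨a, ha, -, h⟩ := exists_sandwich_eq_sum hmn
    ((isEquivariant_of_hecke s).comp (up_equivariant p (rect m k)))
  rw [← sandwich_mul_cell] at h
  rw [hecke_eq_sum h]
  exact sum_smul_cell_mem_cellSpan fun r hr => ha r fun h => hr h.1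

theorem cell_mul_mem (hmn : 2 * m ≤ n) (s : Hecke O n m k) (p : ModType m k) :
    cell O n p * s ∈ cellSpan O n p := by
  obtain ⟨a, ha, -, h⟩ := exists_sandwich_eq_sum hmn
    ((down_equivariant p (rect m k)).comp (isEquivariant_of_hecke s))
  rw [← sandwich_cell_mul] at h
  rw [hecke_eq_sum h]
  exact sum_smul_cell_mem_cellSpan fun r hr => ha r fun h => hr h.2

theorem cellSpan_mono {p q : ModType m k} (h : TypeLE O p q) :
    cellSpan O n p ≤ cellSpan O n q :=
  Submodule.span_mono (Set.image_mono fun _ hr => TypeLE.trans hr h)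

theorem cellSpan_le_cellSpanLT {p q : ModType m k} (h : TypeLE O p q) (hne : p ≠ q) :
    cellSpan O n p ≤ cellSpanLT O n q :=
  Submodule.span_mono (Set.image_mono fun _ hr =>
    ⟨TypeLE.trans hr h, fun he => hne (h.antisymm (he ▸ hr))⟩)

theorem mul_mem_of_span {A : Set (ModType m k)} {I : Submodule ℂ (Hecke O n m k)}
    (s : Hecke O n m k)
    (hA : ∀ r ∈ A, s * cell O n r ∈ I ∧ cell O n r * s ∈ I) {t : Hecke O n m k}
    (ht : t ∈ Submodule.span ℂ (cell O n '' A)) : s * t ∈ I ∧ t * s ∈ I := by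
  induction ht using Submodule.span_induction with
  | mem t ht =>
    obtain ⟨r, hr, rfl⟩ := ht
    exact hA r hr
  | zero => simp
  | add t t' _ _ h h' =>
    rw [mul_add, add_mul]
    exact ⟨I.add_mem h.1 h'.1, I.add_mem h.2 h'.2⟩
  | smul c t _ h =>
    rw [mul_smul_comm, smul_mul_assoc]
    exact ⟨I.smul_mem c h.1, I.smul_mem c h.2⟩

theorem cellSpan_ideal (hmn : 2 * m ≤ n) (p : ModType m k) (s : Hecke O n m k) {t : Hecke O n m k}
    (ht : t ∈ cellSpan O n p) : s * t ∈ cellSpan O n p ∧ t * s ∈ cellSpan O n p :=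
  mul_mem_of_span s (fun r hr => ⟨cellSpan_mono hr (mul_cell_mem hmn s r),
    cellSpan_mono hr (cell_mul_mem hmn s r)⟩) ht

theorem cellSpanLT_ideal (hmn : 2 * m ≤ n) (p : ModType m k) (s : Hecke O n m k)
    {t : Hecke O n m k} (ht : t ∈ cellSpanLT O n p) :
    s * t ∈ cellSpanLT O n p ∧ t * s ∈ cellSpanLT O n p :=
  mul_mem_of_span s (fun r hr => ⟨cellSpan_le_cellSpanLT hr.1 hr.2 (mul_cell_mem hmn s r),
    cellSpan_le_cellSpanLT hr.1 hr.2 (cell_mul_mem hmn s r)⟩) ht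

end Expansion

/-! ### The leading coefficient of `down ∘ up` -/

section LeadingCoefficient

open scoped Classical

variable {O : Type*} [CommRing O] [IsDomain O] [IsDiscreteValuationRing O]
  [Finite (ResidueField O)] {n m k : ℕ}

/-- The duality of submodule lattices for isomorphic submodules `x` and `x'` of the ambient
module. -/
theorem exists_duality_within {x x' : Submodule O (Ambient O n k)} (E : x ≃ₗ[O] x') :
    ∃ D : Submodule O (Ambient O n k) → Submodule O (Ambient O n k),
      (∀ u, D u ≤ x') ∧ (∀ w ≤ x', ∃ u ≤ x, D u = w) ∧
      (∀ u ≤ x, ∀ u' ≤ x, D u ≤ D u' ↔ u' ≤ u) ∧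
      ∀ u, Nonempty (D u ≃ₗ[O] (x ⧸ u.comap x.subtype)) := by
  obtain ⟨ϖ, hϖ⟩ := IsDiscreteValuationRing.exists_irreducible O
  obtain ⟨D, hD, hle, hequiv⟩ := exists_lattice_duality (k := k) hϖ
    (fun a : x => Subtype.ext (pow_smul_ambient_eq_zero hϖ a.1)) E
  have hcomap : ∀ u ≤ x, ∀ u' ≤ x, u.comap x.subtype ≤ u'.comap x.subtype ↔ u ≤ u' :=
    fun u hu u' _ => ⟨fun h a ha => h (x := ⟨a, hu ha⟩) ha, fun h => Submodule.comap_mono h⟩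
  refine ⟨fun u => (D (u.comap x.subtype)).map x'.subtype, fun u => Submodule.map_subtype_le _ _,
    fun w hw => ?_, fun u hu u' hu' => ?_, fun u => ?_⟩
  · obtain ⟨u, hu⟩ := hD.2 (w.comap x'.subtype)
    refine ⟨u.map x.subtype, Submodule.map_subtype_le _ _, ?_⟩
    dsimp only
    rw [Submodule.comap_map_eq_of_injective x.injective_subtype, hu, Submodule.map_comap_subtype,
      inf_eq_right.2 hw]
  · dsimp only
    rw [Submodule.map_le_map_iff_of_injective x'.injective_subtype, hle, hcomap u' hu' u hu]
  · obtain ⟨e⟩ := hequiv (u.comap x.subtype)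
    exact ⟨(Submodule.equivMapOfInjective _ x'.injective_subtype _).symm.trans e⟩

omit [Finite (ResidueField O)] in
/-- If `x ≤ y` and `β` makes the amalgam `β x + y` of `x` and `y` along `u`, then this amalgam is
also the direct sum of `y` and a copy of `x ⧸ u`, the image of `β - 1`. -/
theorem exists_complement_of_separates {x y u : Submodule O (Ambient O n k)} (hxy : x ≤ y)
    {β : Ambient O n k ≃ₗ[O] Ambient O n k} (hβ : Separates β x y u) :
    ∃ V : Submodule O (Ambient O n k), Nonempty ((x ⧸ u.comap x.subtype) ≃ₗ[O] V) ∧ V ⊓ y = ⊥ ∧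
      V ⊔ y = x.map (β : Ambient O n k →ₗ[O] Ambient O n k) ⊔ y := by
  let f : x →ₗ[O] Ambient O n k := β.toLinearMap ∘ₗ x.subtype - x.subtype
  have hf : ∀ a : x, f a = β a - a := fun a => rfl
  have hker : LinearMap.ker f = u.comap x.subtype := by
    ext a
    rw [LinearMap.mem_ker, hf, sub_eq_zero]
    exact ⟨fun h => hβ.2 a a.2 (by rw [h]; exact hxy a.2), fun h => hβ.1 a h⟩
  refine ⟨LinearMap.range f,
    ⟨(Submodule.quotEquivOfEq _ _ hker.symm).trans f.quotKerEquivRange⟩, ?_, ?_⟩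
  · rw [eq_bot_iff]
    rintro _ ⟨⟨a, rfl⟩, ha⟩
    rw [Submodule.mem_bot, hf, sub_eq_zero]
    exact hβ.1 a (hβ.2 a a.2 ((Submodule.sub_mem_iff_left y (hxy a.2)).1 ha))
  · apply le_antisymm
    · refine sup_le ?_ le_sup_right
      rintro _ ⟨a, rfl⟩
      exact Submodule.sub_mem _ (Submodule.mem_sup_left (Submodule.mem_map_of_mem a.2))
        (Submodule.mem_sup_right (hxy a.2))
    · refine sup_le ?_ le_sup_right
      rintro _ ⟨a, ha, rfl⟩
      have : (β : Ambient O n k →ₗ[O] Ambient O n k) a = f ⟨a, ha⟩ + a := by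
        rw [hf]
        simp
      rw [this]
      exact Submodule.add_mem _ (Submodule.mem_sup_left ⟨_, rfl⟩) (Submodule.mem_sup_right (hxy ha))

/-- The kernel of `down ∘ up` counts the submodules that contain two given ones. -/
theorem kernel_down_up {p q r : ModType m k} (x : Gr O n p) (y : Gr O n q) :
    kernel (down O n r q ∘ₗ up O n p r) x y =
      (Set.ncard {z : Submodule O (Ambient O n k) | HasType z r ∧ x.1 ≤ z ∧ y.1 ≤ z} : ℂ) := by
  rw [kernel, LinearMap.comp_apply, up_single, down_apply, Finset.sum_filter,
    sum_Gr_eq (fun z => if y.1 ≤ z then if x.1 ≤ z then (1 : ℂ) else 0 else 0),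
    ← Nat.card_coe_set_eq, Nat.card_eq_fintype_card, Fintype.card_subtype, Finset.card_filter,
    Nat.cast_sum, Finset.sum_filter]
  refine Finset.sum_congr rfl fun z _ => ?_
  simp only [Set.mem_ofPred_eq, Nat.cast_ite, Nat.cast_one, Nat.cast_zero]
  split_ifs <;> tauto

/-- The reduced kernel of `down ∘ up` at a pair `x ≤ y`, amalgamated along all of `x`, is the number
of `z ≥ y` transversal to a copy `x'` of `x` with `x' ⊓ y = ⊥`. The amalgam of `x` and `y` along
`u ≤ x` is isomorphic to `y ⊕ x ⧸ u`, hence to `y ⊕ D u`, where `D` is an anti-isomorphism from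
the submodules of `x` to those of `x'`. So the submodules `z` that contain it are sorted by
`z ⊓ x' ≥ D u`, and the Möbius transform at `x` picks out those with `z ⊓ x' = D x = ⊥`. -/
theorem reduced_down_up (hmn : 2 * m ≤ n) {p q r : ModType m k} {x : Gr O n p} {y : Gr O n q}
    (hxy : x.1 ≤ y.1) :
    reduced (kernel (down O n r q ∘ₗ up O n p r)) x y x.1 = avoid O n q r p := by
  have hs := isInvariant_kernel ((down_equivariant (O := O) (n := n) q r).comp
    (up_equivariant p r))
  obtain ⟨α, -, hα⟩ := exists_separates hmn x.2 y.2 (u := ⊥) bot_le bot_le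
  set x' := x.1.map (α : Ambient O n k →ₗ[O] Ambient O n k) with hx'
  have hdisj : x' ⊓ y.1 = ⊥ := by
    rw [eq_bot_iff]
    rintro _ ⟨⟨a, ha, rfl⟩, hy⟩
    have := hα a ha hy
    rw [Submodule.mem_bot] at this
    simp [this]
  obtain ⟨D, hDle, hDsurj, hDiff, hDequiv⟩ := exists_duality_within (α.submoduleMap x.1)
  have hDtop : D x.1 = ⊥ := by
    obtain ⟨u, hu, hu'⟩ := hDsurj ⊥ bot_le
    rw [eq_bot_iff, ← hu']
    exact (hDiff x.1 le_rfl u hu).2 hu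
  rw [← avoidCount_eq_avoid (x := y.1) (w := x') ⟨y.2, (hasType_map_iff α _).2 x.2, by
    rw [inf_comm, hdisj]⟩]
  have hτ : ∀ u, (Set.ncard {z : Submodule O (Ambient O n k) |
      HasType z r ∧ y.1 ≤ z ∧ z ⊓ x' = D u} : ℂ) =
      ∑ z : Submodule O (Ambient O n k), if HasType z r ∧ y.1 ≤ z ∧ z ⊓ x' = D u then 1 else 0 := by
    intro u
    rw [← Nat.card_coe_set_eq, Nat.card_eq_fintype_card, Fintype.card_subtype, Finset.card_filter,
      Nat.cast_sum]
    simp only [Set.mem_ofPred_eq, Nat.cast_ite, Nat.cast_one, Nat.cast_zero]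
  refine (moebiusTransform_eq (f := fun u => (Set.ncard {z : Submodule O (Ambient O n k) |
      HasType z r ∧ y.1 ≤ z ∧ z ⊓ x' = D u} : ℂ)) fun u hu => ?_).trans ?_
  swap
  · rw [hDtop]
    rfl
  obtain ⟨β, hβ⟩ := exists_separates hmn x.2 y.2 hu (hu.trans hxy)
  rw [amalgam_eq hs (hu.trans hxy) hβ, kernel_down_up]
  -- the left side counts the `z ≥ y` with `z ⊓ x' ≥ D u`
  have hleft : ∑ c with c ≤ u, (Set.ncard {z : Submodule O (Ambient O n k) |
      HasType z r ∧ y.1 ≤ z ∧ z ⊓ x' = D c} : ℂ) =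
      (Set.ncard {z : Submodule O (Ambient O n k) | HasType z r ∧ D u ⊔ y.1 ≤ z} : ℂ) := by
    rw [Finset.sum_congr rfl fun c _ => hτ c, Finset.sum_comm, ← Nat.card_coe_set_eq,
      Nat.card_eq_fintype_card, Fintype.card_subtype, Finset.card_filter, Nat.cast_sum]
    refine Finset.sum_congr rfl fun z _ => ?_
    obtain ⟨c, hc, hcz⟩ := hDsurj (z ⊓ x') inf_le_right
    have huniq : ∀ c' ≤ u, z ⊓ x' = D c' ↔ c' = c := fun c' hc' => by
      rw [← hcz]
      constructor
      · intro h
        exact le_antisymm ((hDiff c hc c' (hc'.trans hu)).1 h.le)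
          ((hDiff c' (hc'.trans hu) c hc).1 h.ge)
      · rintro rfl
        rfl
    have hcu : c ≤ u ↔ D u ≤ z := by
      rw [← hDiff u hu c hc, hcz, le_inf_iff]
      exact and_iff_left (hDle u)
    simp only [Set.mem_ofPred_eq, Nat.cast_ite, Nat.cast_one, Nat.cast_zero, sup_le_iff, ← hcu]
    rw [Finset.sum_filter, Finset.sum_eq_single c]
    · by_cases h : c ≤ u
      · simp [h, huniq c h]
      · simp [h]
    · intro c' _ hne
      split_ifs with h₁ h₂
      · exact absurd ((huniq c' h₁).1 h₂.2.2) hne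
      · rfl
      · rfl
    · simp
  obtain ⟨V, ⟨e⟩, hV, hVsup⟩ := exists_complement_of_separates hxy hβ
  obtain ⟨γ, -, hγ⟩ := exists_equiv_extending_equiv ((hDequiv u).some.trans e)
  obtain ⟨ε, h₁, h₂⟩ := exists_glue_of_disjoint
    (eq_bot_iff.2 ((inf_le_inf_right _ (hDle u)).trans hdisj.le)) hV γ (LinearEquiv.refl _ _) hγ
    (Submodule.map_id _)
  have hε : (D u ⊔ y.1).map (ε : Ambient O n k →ₗ[O] Ambient O n k) =
      x.1.map (β : Ambient O n k →ₗ[O] Ambient O n k) ⊔ y.1 := by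
    rw [Submodule.map_sup, map_eq_map_of_agree h₁, hγ, map_eq_map_of_agree h₂, ← hVsup]
    congr 1
    exact Submodule.map_id _
  rw [hleft, ncard_map_eq (Q := fun z => HasType z r ∧ x.1.map
    (β : Ambient O n k →ₗ[O] Ambient O n k) ⊔ y.1 ≤ z) ε fun z => by
      rw [hasType_map_iff, ← hε, map_le_map_equiv_iff]]
  simp only [sup_le_iff]
  rfl

theorem coefficient_down_up (hmn : 2 * m ≤ n) {p q : ModType m k}
    {z z' v : Submodule O (Ambient O n k)} (hz' : HasType z' (rect m k)) (hv : HasType v p)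
    (hvz : v ≤ z) (hvz' : v ≤ z') :
    coefficient (kernel (down O n (rect m k) q ∘ₗ up O n p (rect m k))) z z' v =
      (between O n p q (rect m k) : ℂ) * (avoid O n q (rect m k) p : ℂ) := by
  rw [coefficient, Finset.sum_eq_single (⟨v, hv⟩ : Gr O n p)]
  · rw [Finset.sum_congr rfl fun y hy => reduced_down_up (x := ⟨v, hv⟩) hmn
      (Finset.mem_filter.1 hy).2.1, Finset.sum_const, nsmul_eq_mul]
    congr 2
    rw [← betweenCount_eq_between ⟨hv, hz', hvz'⟩, betweenCount, ← Nat.card_coe_set_eq,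
      Nat.card_eq_fintype_card, Fintype.card_subtype, Finset.card_filter, Finset.card_filter,
      ← Finset.sum_filter, ← Finset.sum_filter]
    simp only [Finset.sum_const, smul_eq_mul, mul_one]
    refine Finset.card_bij (fun y _ => y.1) (fun y hy => ?_) (fun y _ y' _ h => Subtype.ext h)
      fun y hy => ?_
    · simp only [Finset.mem_filter, Finset.mem_univ, true_and, Set.mem_ofPred_eq] at hy ⊢
      exact ⟨y.2, hy⟩
    · simp only [Finset.mem_filter, Finset.mem_univ, true_and, Set.mem_ofPred_eq] at hy
      exact ⟨⟨y, hy.1⟩, by simpa using hy.2, rfl⟩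
  · intro x hx hne
    exact absurd (Subtype.ext (hv.eq_of_le x.2 (Finset.mem_filter.1 hx).2.1).symm) hne
  · intro h
    exact absurd (Finset.mem_filter.2 ⟨Finset.mem_univ _, le_rfl, hvz⟩) h

/-- The expansion of `c_q * c_p` in the cellular basis: only `c_r` with `r ≤ p` and `r ≤ q` occur,
and the coefficient of `c_p` is known if `p ≤ q`. -/
theorem exists_sandwich_down_up (hmn : 2 * m ≤ n) (p q : ModType m k) :
    ∃ a : ModType m k → ℂ, (∀ r, ¬ (TypeLE O r p ∧ TypeLE O r q) → a r = 0) ∧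
      (a p = if TypeLE O p q then
        (between O n p q (rect m k) : ℂ) * (avoid O n q (rect m k) p : ℂ) else 0) ∧
      sandwich (down O n (rect m k) q ∘ₗ up O n p (rect m k)) =
        ∑ r, a r • (cell O n r : Module.End ℂ (Fun O n (rect m k))) := by
  obtain ⟨a, ha, hcoef, hsum⟩ := exists_sandwich_eq_sum hmn
    ((down_equivariant (O := O) (n := n) q (rect m k)).comp (up_equivariant p (rect m k)))
  refine ⟨a, ha, ?_, hsum⟩
  split_ifs with h
  · obtain ⟨v, _, z, hv, _, hz, hvy, hyz⟩ := exists_chain (O := O) (n := n) (by omega) h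
    rw [← coefficient_down_up hmn hz hv (hvy.trans hyz) (hvy.trans hyz)]
    exact (hcoef p z z v hz hz hv (hvy.trans hyz) (hvy.trans hyz)).symm
  · exact ha p fun h' => h h'.2

/-! ### Goodness -/

theorem up_comp_up (r q : ModType m k) :
    up O n q (rect m k) ∘ₗ up O n r q =
      (between O n r q (rect m k) : ℂ) • up O n r (rect m k) := by
  refine ext_kernel fun x z => ?_
  rw [kernel, kernel, LinearMap.comp_apply, LinearMap.smul_apply, up_single, up_apply, up_single,
    Pi.smul_apply, Finset.sum_filter,
    sum_Gr_eq (fun y => if y ≤ z.1 then if x.1 ≤ y then (1 : ℂ) else 0 else 0)]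
  by_cases h : x.1 ≤ z.1
  · rw [if_pos h, ← betweenCount_eq_between ⟨x.2, z.2, h⟩, betweenCount, ← Nat.card_coe_set_eq,
      Nat.card_eq_fintype_card, Fintype.card_subtype, Finset.card_filter, Nat.cast_sum,
      Finset.sum_filter, smul_eq_mul, mul_one]
    refine Finset.sum_congr rfl fun y _ => ?_
    simp only [Set.mem_ofPred_eq, Nat.cast_ite, Nat.cast_one, Nat.cast_zero]
    split_ifs <;> tauto
  · rw [if_neg h, smul_zero]
    refine Finset.sum_eq_zero fun y _ => ?_
    split_ifs with h₁ h₂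
    · exact absurd (h₂.trans h₁) h
    · rfl
    · rfl

theorem down_comp_down (r p : ModType m k) :
    down O n p r ∘ₗ down O n (rect m k) p =
      (between O n r p (rect m k) : ℂ) • down O n (rect m k) r := by
  refine ext_kernel fun z x => ?_
  have := congrFun (LinearMap.congr_fun (up_comp_up (O := O) (n := n) r p) (Pi.single x 1)) z
  rw [LinearMap.comp_apply, LinearMap.smul_apply, up_single, up_apply, up_single,
    Pi.smul_apply, Finset.sum_filter] at this
  rw [kernel, kernel, LinearMap.comp_apply, LinearMap.smul_apply, down_single, down_apply,
    down_single, Pi.smul_apply, Finset.sum_filter, ← this]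
  refine Finset.sum_congr rfl fun y _ => ?_
  split_ifs <;> rfl

theorem sandwich_deltaMap (p q : ModType m k) (r : LowerBounds O p q) :
    sandwich (deltaMap O n p q r) =
      ((between O n r.1 q (rect m k) : ℂ) * (between O n r.1 p (rect m k) : ℂ)) •
        (cell O n r.1 : Module.End ℂ (Fun O n (rect m k))) := by
  rw [sandwich, deltaMap, LinearMap.comp_assoc, down_comp_down, ← LinearMap.comp_assoc,
    up_comp_up, LinearMap.smul_comp, LinearMap.comp_smul, smul_smul]
  rfl

theorem sum_smul_cell_eq_sum_sandwich (hmn : 2 * m ≤ n) {p q : ModType m k} {a : ModType m k → ℂ}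
    (ha : ∀ r, ¬ (TypeLE O r p ∧ TypeLE O r q) → a r = 0) :
    ∑ r, a r • (cell O n r : Module.End ℂ (Fun O n (rect m k))) =
      ∑ r : LowerBounds O p q, (a r.1 /
        ((between O n r.1 q (rect m k) : ℂ) * (between O n r.1 p (rect m k) : ℂ))) •
          sandwich (deltaMap O n p q r) := by
  have h1 : ∀ r : LowerBounds O p q, (a r.1 /
      ((between O n r.1 q (rect m k) : ℂ) * (between O n r.1 p (rect m k) : ℂ))) •
        sandwich (deltaMap O n p q r) =
      a r.1 • (cell O n r.1 : Module.End ℂ (Fun O n (rect m k))) := fun r => by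
    have h₁ := (between_pos (O := O) (n := n) (by omega) r.2.1).ne'
    have h₂ := (between_pos (O := O) (n := n) (by omega) r.2.2).ne'
    rw [sandwich_deltaMap, smul_smul, div_mul_cancel₀]
    exact mul_ne_zero (Nat.cast_ne_zero.2 h₂) (Nat.cast_ne_zero.2 h₁)
  rw [Finset.sum_congr rfl fun r _ => h1 r,
    ← Finset.sum_subtype (Finset.univ.filter fun r => TypeLE O r p ∧ TypeLE O r q) (by simp)
      (fun r => a r • (cell O n r : Module.End ℂ (Fun O n (rect m k)))), Finset.sum_filter]
  refine Finset.sum_congr rfl fun r _ => ?_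
  split_ifs with h
  · rfl
  · rw [ha r h, zero_smul]

theorem isGood_rect (hmn : 2 * m ≤ n) {p q : ModType m k} (hpq : TypeLE O p q) :
    IsGood n hpq (rect m k) := by
  refine ⟨?_, fun S hS => ?_, ?_⟩
  · have h1 := (linearIndependent_cell_coe (O := O) hmn).comp (fun r : LowerBounds O p q => r.1)
      Subtype.val_injective
    have h2 : ∀ r : LowerBounds O p q,
        IsUnit ((between O n r.1 q (rect m k) : ℂ) * (between O n r.1 p (rect m k) : ℂ)) :=
      fun r => by
        have h₁ := (between_pos (O := O) (n := n) (by omega) r.2.1).ne'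
        have h₂ := (between_pos (O := O) (n := n) (by omega) r.2.2).ne'
        exact (mul_ne_zero (Nat.cast_ne_zero.2 h₂) (Nat.cast_ne_zero.2 h₁)).isUnit
    have h3 := h1.units_smul fun r => (h2 r).unit
    convert h3 using 1
    funext r
    rw [sandwich_deltaMap]
    rfl
  · obtain ⟨a, ha, -, h⟩ := exists_sandwich_eq_sum hmn hS
    rw [h, sum_smul_cell_eq_sum_sandwich hmn ha]
    exact Submodule.sum_mem _ fun r _ => Submodule.smul_mem _ _ (Submodule.subset_span ⟨r, rfl⟩)
  · obtain ⟨a, ha, hap, h⟩ := exists_sandwich_down_up (O := O) hmn p q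
    refine ⟨_, h.trans (sum_smul_cell_eq_sum_sandwich hmn ha), ?_⟩
    have h₁ := (between_pos (O := O) (n := n) (by omega) hpq).ne'
    dsimp only
    rw [hap, if_pos hpq, between_self (by omega), Nat.cast_one, mul_one,
      mul_div_cancel_left₀ _ (Nat.cast_ne_zero.2 h₁)]

end LeadingCoefficient

/-! ### Algebras with a triangular character table -/

section CellFiltration

open scoped Classical

variable {A : Type*} [Ring A] [Algebra ℂ A] {ι : Type*} [Fintype ι]

/-- A family of pairs `I p`, `J p` of subspaces, with `J p` a left ideal, such that every element `t`
of `I p` is congruent modulo `J p` to the multiple of `b p` given by the coordinate of `t` in the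
basis `b`. The algebra then acts on the one-dimensional quotients `I p / J p` by scalars. -/
structure IsCellFiltration (b : Module.Basis ι ℂ A) (I J : ι → Submodule ℂ A) : Prop where
  mem : ∀ p, b p ∈ I p
  coord_eq_zero : ∀ p, ∀ t ∈ J p, b.coord p t = 0
  exists_add : ∀ p, ∀ t ∈ I p, ∃ r ∈ J p, t = b.coord p t • b p + r
  mul_mem : ∀ p s, s * b p ∈ I p
  mul_mem' : ∀ p s, ∀ t ∈ J p, s * t ∈ J p

/-- The scalars by which the elements of an algebra act on the quotients of a cell filtration: the
coefficient of `b p` in `s * b p`. -/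
def cellCharacter (b : Module.Basis ι ℂ A) : A →ₗ[ℂ] (ι → ℂ) :=
  LinearMap.pi fun p => b.coord p ∘ₗ LinearMap.mulRight ℂ (b p)

omit [Fintype ι] in
theorem cellCharacter_apply (b : Module.Basis ι ℂ A) (s : A) (p : ι) :
    cellCharacter b s p = b.coord p (s * b p) := rfl

variable {b : Module.Basis ι ℂ A} {I J : ι → Submodule ℂ A}

omit [Fintype ι] in
theorem IsCellFiltration.mul_sub_mem (h : IsCellFiltration b I J) (s : A) {p : ι} {t : A}
    (ht : t ∈ I p) : s * t - cellCharacter b s p • t ∈ J p := by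
  obtain ⟨r, hr, hrt⟩ := h.exists_add p t ht
  obtain ⟨r', hr', hrs⟩ := h.exists_add p _ (h.mul_mem p s)
  rw [← cellCharacter_apply] at hrs
  have h3 : s * t - cellCharacter b s p • t =
      b.coord p t • r' + (s * r - cellCharacter b s p • r) := by
    generalize b.coord p t = c at hrt
    rw [hrt, mul_add, mul_smul_comm, hrs]
    module
  rw [h3]
  exact (J p).add_mem ((J p).smul_mem _ hr')
    ((J p).sub_mem (h.mul_mem' p s r hr) ((J p).smul_mem _ hr))

omit [Fintype ι] in
theorem IsCellFiltration.cellCharacter_mul (h : IsCellFiltration b I J) (s t : A) :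
    cellCharacter b (s * t) = cellCharacter b s * cellCharacter b t := by
  funext p
  have h := h.coord_eq_zero p _ (h.mul_sub_mem s (h.mul_mem p t))
  rw [map_sub, map_smul, sub_eq_zero, ← mul_assoc] at h
  exact h

/-- A basis is called triangular if its character table is triangular, with nonzero diagonal, with
respect to a relation that increases a rank function. -/
structure IsTriangular (b : Module.Basis ι ℂ A) (le : ι → ι → Prop) (rank : ι → ℕ) : Prop where
  rank_lt : ∀ p q, le p q → p ≠ q → rank p < rank q
  eq_zero : ∀ p q, ¬ le p q → cellCharacter b (b q) p = 0
  ne_zero : ∀ p, cellCharacter b (b p) p ≠ 0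

theorem IsTriangular.injective {le : ι → ι → Prop} {rank : ι → ℕ} (h : IsTriangular b le rank) :
    Function.Injective (cellCharacter b) := by
  rw [← LinearMap.ker_eq_bot, LinearMap.ker_eq_bot']
  intro s hs
  by_contra hne
  have ha : b.repr s ≠ 0 := fun h => hne (b.repr.map_eq_zero_iff.1 h)
  -- a basis element of maximal rank in the expansion of `s` is detected by its own character
  obtain ⟨p, hp, hmax⟩ := Finset.exists_max_image (b.repr s).support rank
    (Finsupp.support_nonempty_iff.2 ha)
  have h0 := congrFun hs p
  rw [← b.sum_repr s, map_sum, Finset.sum_apply, Finset.sum_eq_single p] at h0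
  · rw [map_smul, Pi.smul_apply, Pi.zero_apply, smul_eq_zero] at h0
    exact h0.elim (Finsupp.mem_support_iff.1 hp) (h.ne_zero p)
  · intro r _ hr
    rw [map_smul, Pi.smul_apply]
    by_cases hpr : le p r
    · by_cases har : b.repr s r = 0
      · rw [har, zero_smul]
      · exact absurd (hmax r (Finsupp.mem_support_iff.2 har))
          (not_le.2 (h.rank_lt p r hpr hr.symm))
    · rw [h.eq_zero p r hpr, smul_zero]
  · simp

/-- The characters of a triangular basis identify the algebra with an algebra of functions. -/
def IsTriangular.equiv {le : ι → ι → Prop} {rank : ι → ℕ} (h : IsTriangular b le rank) :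
    A ≃ₗ[ℂ] (ι → ℂ) :=
  haveI : FiniteDimensional ℂ A := Module.Basis.finiteDimensional_of_finite b
  LinearMap.linearEquivOfInjective (cellCharacter b) h.injective (by
    rw [Module.finrank_eq_card_basis b, Module.finrank_fintype_fun_eq_card])

/-- The basis dual to the characters of a triangular basis. -/
def IsTriangular.dualBasis {le : ι → ι → Prop} {rank : ι → ℕ} (h : IsTriangular b le rank) :
    Module.Basis ι ℂ A :=
  (Pi.basisFun ℂ ι).map h.equiv.symm

variable {le : ι → ι → Prop} {rank : ι → ℕ}

theorem IsTriangular.cellCharacter_dualBasis (h : IsTriangular b le rank) (p : ι) :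
    cellCharacter b (h.dualBasis p) = Pi.single p 1 := by
  have : ∀ s, cellCharacter b s = h.equiv s := fun s => rfl
  rw [this, dualBasis, Module.Basis.map_apply, LinearEquiv.apply_symm_apply, Pi.basisFun_apply]

theorem IsTriangular.eq_sum_dualBasis (h : IsTriangular b le rank) (s : A) :
    s = ∑ p, cellCharacter b s p • h.dualBasis p :=
  (h.dualBasis.sum_repr s).symm

theorem IsTriangular.dualBasis_mul_self (h : IsTriangular b le rank)
    (hf : IsCellFiltration b I J) (p : ι) : h.dualBasis p * h.dualBasis p = h.dualBasis p :=
  h.injective (by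
    rw [hf.cellCharacter_mul, h.cellCharacter_dualBasis, ← Pi.single_mul, mul_one])

theorem IsTriangular.dualBasis_minimal (h : IsTriangular b le rank)
    (hf : IsCellFiltration b I J) (p : ι) (f : A) (hff : f * f = f) (hef : h.dualBasis p * f = f) :
    f = 0 ∨ f = h.dualBasis p := by
  have h1 : cellCharacter b f = Pi.single p (cellCharacter b f p) := by
    have := congrArg (cellCharacter b) hef
    rw [hf.cellCharacter_mul, h.cellCharacter_dualBasis, ← Pi.single_mul_left, one_mul] at this
    exact this.symm
  have h2 := congrFun (congrArg (cellCharacter b) hff) p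
  rw [hf.cellCharacter_mul, Pi.mul_apply] at h2
  rcases IsIdempotentElem.iff_eq_zero_or_one.1 h2 with h0 | h0
  · left
    apply h.injective
    rw [h1, h0, Pi.single_zero, map_zero]
  · right
    apply h.injective
    rw [h1, h0, h.cellCharacter_dualBasis]

theorem IsTriangular.dualBasis_act_self (h : IsTriangular b le rank)
    (hf : IsCellFiltration b I J) (p : ι) (t : A) (ht : t ∈ I p) :
    h.dualBasis p * t - t ∈ J p := by
  have := hf.mul_sub_mem (h.dualBasis p) ht
  rwa [h.cellCharacter_dualBasis, Pi.single_eq_same, one_smul] at this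

theorem IsTriangular.dualBasis_act_other (h : IsTriangular b le rank)
    (hf : IsCellFiltration b I J) (p q : ι) (hq : q ≠ p) (t : A) (ht : t ∈ I q) :
    h.dualBasis p * t ∈ J q := by
  have := hf.mul_sub_mem (h.dualBasis p) ht
  rwa [h.cellCharacter_dualBasis, Pi.single_eq_of_ne hq, zero_smul, sub_zero] at this

/-- An element that acts on the quotients of the cell filtration like a member of the dual basis is
equal to it. -/
theorem IsTriangular.eq_dualBasis (h : IsTriangular b le rank) (hf : IsCellFiltration b I J)
    (p : ι) (f : A) (hself : ∀ t ∈ I p, f * t - t ∈ J p)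
    (hother : ∀ q, q ≠ p → ∀ t ∈ I q, f * t ∈ J q) : f = h.dualBasis p := by
  apply h.injective
  rw [h.cellCharacter_dualBasis]
  funext q
  rw [cellCharacter_apply]
  by_cases hq : q = p
  · subst hq
    have := hf.coord_eq_zero q _ (hself _ (hf.mem q))
    rw [map_sub, sub_eq_zero] at this
    rw [this, Pi.single_eq_same]
    simp [Module.Basis.coord_apply]
  · rw [hf.coord_eq_zero q _ (hother q hq _ (hf.mem q)), Pi.single_eq_of_ne hq]

end CellFiltration

/-! ### The minimal idempotents of the Hecke algebra -/

section Idempotents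

open scoped Classical

variable {O : Type*} [CommRing O] [IsDomain O] [IsDiscreteValuationRing O]
  [Finite (ResidueField O)] {n m k : ℕ}

/-- The cellular basis `c_p` of the Hecke algebra. -/
def cellBasis (hmn : 2 * m ≤ n) : Module.Basis (ModType m k) ℂ (Hecke O n m k) :=
  Module.Basis.mk (linearIndependent_cell hmn) (span_cell_eq_top hmn).ge

theorem cellBasis_apply (hmn : 2 * m ≤ n) (p : ModType m k) :
    cellBasis hmn p = cell O n p :=
  Module.Basis.mk_apply _ _ _

theorem coord_cell (hmn : 2 * m ≤ n) (p q : ModType m k) :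
    (cellBasis hmn).coord q (cell O n p) = if p = q then 1 else 0 := by
  rw [← cellBasis_apply hmn, Module.Basis.coord_apply, Module.Basis.repr_self,
    Finsupp.single_apply]

theorem coord_eq_zero_of_mem (hmn : 2 * m ≤ n) {p : ModType m k} {t : Hecke O n m k}
    (ht : t ∈ cellSpanLT O n p) : (cellBasis hmn).coord p t = 0 := by
  have : cellSpanLT O n p ≤ LinearMap.ker ((cellBasis hmn).coord p) := by
    refine Submodule.span_le.2 ?_
    rintro _ ⟨r, hr, rfl⟩
    exact (coord_cell hmn r p).trans (if_neg hr.2)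
  exact this ht

theorem cellSpan_le_sup (p : ModType m k) :
    cellSpan O n p ≤ Submodule.span ℂ {cell O n p} ⊔ cellSpanLT O n p := by
  refine Submodule.span_le.2 ?_
  rintro _ ⟨r, hr, rfl⟩
  by_cases h : r = p
  · exact Submodule.mem_sup_left (Submodule.subset_span (by rw [h]; rfl))
  · exact Submodule.mem_sup_right (Submodule.subset_span ⟨r, ⟨hr, h⟩, rfl⟩)

theorem isCellFiltration (hmn : 2 * m ≤ n) :
    IsCellFiltration (A := Hecke O n m k) (cellBasis hmn) (cellSpan O n) (cellSpanLT O n) where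
  mem p := by
    rw [cellBasis_apply]
    exact Submodule.subset_span ⟨p, TypeLE.refl O p, rfl⟩
  coord_eq_zero p t ht := coord_eq_zero_of_mem hmn ht
  exists_add p t ht := by
    obtain ⟨s, hs, r, hr, rfl⟩ := Submodule.mem_sup.1 (cellSpan_le_sup p ht)
    obtain ⟨c, rfl⟩ := Submodule.mem_span_singleton.1 hs
    refine ⟨r, hr, ?_⟩
    rw [map_add, map_smul, coord_cell, if_pos rfl, coord_eq_zero_of_mem hmn hr, smul_eq_mul,
      mul_one, add_zero, cellBasis_apply]
  mul_mem p s := by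
    rw [cellBasis_apply]
    exact mul_cell_mem hmn s p
  mul_mem' p s t ht := (cellSpanLT_ideal hmn p s ht).1

/-- The values of the characters at the cellular elements. -/
theorem cellCharacter_cell (hmn : 2 * m ≤ n) (q p : ModType m k) :
    cellCharacter (A := Hecke O n m k) (cellBasis hmn) (cell O n q) p = if TypeLE O p q then
      (between O n p q (rect m k) : ℂ) * (avoid O n q (rect m k) p : ℂ) else 0 := by
  obtain ⟨a, -, hap, h⟩ := exists_sandwich_down_up (O := O) hmn p q
  have h' : cell O n q * cell O n p = ∑ r, a r • cell O n r := hecke_eq_sum h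
  rw [cellCharacter_apply, cellBasis_apply, h', map_sum, ← hap, Finset.sum_eq_single p]
  · rw [map_smul, coord_cell, if_pos rfl, smul_eq_mul, mul_one]
  · intro r _ hr
    rw [map_smul, coord_cell, if_neg hr, smul_zero]
  · simp

theorem isTriangular (hmn : 2 * m ≤ n) :
    IsTriangular (A := Hecke O n m k) (cellBasis hmn) (TypeLE O) (fun p => ∑ i, p.part i) where
  rank_lt p q hpq hne := by
    have h1 : ∀ i ∈ Finset.univ, p.part i ≤ q.part i := fun i _ => hpq.part_le i
    refine lt_of_le_of_ne (Finset.sum_le_sum h1) fun h => hne ?_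
    have h2 := (Finset.sum_eq_sum_iff_of_le h1).1 h
    exact ModType.ext (funext fun i => h2 i (Finset.mem_univ i))
  eq_zero p q hpq := by
    rw [cellBasis_apply, cellCharacter_cell, if_neg hpq]
  ne_zero p := by
    rw [cellBasis_apply, cellCharacter_cell, if_pos (TypeLE.refl O p), between_self (by omega),
      Nat.cast_one, one_mul]
    exact Nat.cast_ne_zero.2 (avoid_pos hmn p p).ne'

/-- The basis of the Hecke algebra that is dual to the characters of the cell modules. -/
def idempotentBasis (hmn : 2 * m ≤ n) : Module.Basis (ModType m k) ℂ (Hecke O n m k) :=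
  (isTriangular hmn).dualBasis

theorem idempotentBasis_mul_self (hmn : 2 * m ≤ n) (p : ModType m k) :
    idempotentBasis (O := O) hmn p * idempotentBasis hmn p = idempotentBasis hmn p :=
  (isTriangular hmn).dualBasis_mul_self (isCellFiltration hmn) p

theorem idempotentBasis_minimal (hmn : 2 * m ≤ n) (p : ModType m k) (f : Hecke O n m k)
    (hf : f * f = f) (hef : idempotentBasis hmn p * f = f) : f = 0 ∨ f = idempotentBasis hmn p :=
  (isTriangular hmn).dualBasis_minimal (isCellFiltration hmn) p f hf hef

theorem idempotentBasis_act_self (hmn : 2 * m ≤ n) (p : ModType m k) :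
    ∀ t ∈ cellSpan O n p, idempotentBasis hmn p * t - t ∈ cellSpanLT O n p :=
  (isTriangular hmn).dualBasis_act_self (isCellFiltration hmn) p

theorem idempotentBasis_act_other (hmn : 2 * m ≤ n) (p q : ModType m k) (hq : q ≠ p) :
    ∀ t ∈ cellSpan O n q, idempotentBasis hmn p * t ∈ cellSpanLT O n q :=
  (isTriangular hmn).dualBasis_act_other (isCellFiltration hmn) p q hq

theorem isCellIdempotent_idempotentBasis (hmn : 2 * m ≤ n) (p : ModType m k) :
    IsCellIdempotent (idempotentBasis (O := O) hmn p) p where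
  ne_zero := (idempotentBasis hmn).ne_zero p
  idem := idempotentBasis_mul_self hmn p
  minimal f hf hef _ := idempotentBasis_minimal hmn p f hf hef
  act_self := idempotentBasis_act_self hmn p
  act_other := idempotentBasis_act_other hmn p

theorem IsCellIdempotent.eq_idempotentBasis (hmn : 2 * m ≤ n) {f : Hecke O n m k}
    {p : ModType m k} (hf : IsCellIdempotent f p) : f = idempotentBasis hmn p :=
  (isTriangular hmn).eq_dualBasis (isCellFiltration hmn) p f hf.act_self hf.act_other

theorem cell_eq_sum_idempotentBasis (hmn : 2 * m ≤ n) (q : ModType m k) :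
    cell O n q = ∑ p : ModType m k with TypeLE O p q,
      ((between O n p q (rect m k) : ℂ) * (avoid O n q (rect m k) p : ℂ)) •
        idempotentBasis hmn p := by
  refine ((isTriangular hmn).eq_sum_dualBasis (cell O n q)).trans ?_
  rw [Finset.sum_filter]
  refine Finset.sum_congr rfl fun p _ => ?_
  rw [cellCharacter_cell]
  split_ifs
  · rfl
  · rw [zero_smul]

end Idempotents

end FiniteGrassmannian

end

open FiniteGrassmannian in
open Classical in
theorem mainTheorem2 (O : Type*) [CommRing O] [IsDomain O] [IsDiscreteValuationRing O]
    [Finite (IsLocalRing.ResidueField O)] (m n k : ℕ) (hmn : 2 * m ≤ n) :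
    -- the counting numbers exist and do not depend on the choice of the fixed modules
    (∀ κ lam : ModType m k, TypeLE O κ lam →
      ((∃ x z : Submodule O (Ambient O n k), IsNested κ (rect m k) x z) ∧
        ∀ x z : Submodule O (Ambient O n k), IsNested κ (rect m k) x z →
          betweenCount lam x z = between O n κ lam (rect m k)) ∧
      ((∃ x w : Submodule O (Ambient O n k), IsTransversal lam κ x w) ∧
        ∀ x w : Submodule O (Ambient O n k), IsTransversal lam κ x w →
          avoidCount (rect m k) x w = avoid O n lam (rect m k) κ)) ∧
    -- the cellular elements form a basis, and their spans are ideals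
    (LinearIndependent ℂ (fun lam : ModType m k => cell O n lam) ∧
      Submodule.span ℂ (Set.range fun lam : ModType m k => cell O n lam) = ⊤) ∧
    (∀ (lam : ModType m k) (s t : Hecke O n m k),
      (t ∈ cellSpan O n lam → s * t ∈ cellSpan O n lam ∧ t * s ∈ cellSpan O n lam) ∧
      (t ∈ cellSpanLT O n lam → s * t ∈ cellSpanLT O n lam ∧ t * s ∈ cellSpanLT O n lam)) ∧
    -- the expansion of the cellular basis in the minimal idempotents
    (∃ e : Module.Basis (ModType m k) ℂ (Hecke O n m k),
      (∀ κ, IsCellIdempotent (e κ) κ) ∧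
      (∀ κ f, IsCellIdempotent f κ → f = e κ) ∧
      ∀ lam : ModType m k,
        cell O n lam = ∑ κ : ModType m k with TypeLE O κ lam,
          ((between O n κ lam (rect m k) : ℂ) * (avoid O n lam (rect m k) κ : ℂ)) • e κ) ∧
    -- every triple is good
    (∀ (κ lam : ModType m k) (h : TypeLE O κ lam), IsGood n h (rect m k)) := by
  refine ⟨fun κ lam hκ => ⟨⟨?_, fun x z h => betweenCount_eq_between h⟩,
    ?_, fun x w h => avoidCount_eq_avoid h⟩,
    ⟨linearIndependent_cell hmn, span_cell_eq_top hmn⟩,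
    fun lam s t => ⟨cellSpan_ideal hmn lam s, cellSpanLT_ideal hmn lam s⟩,
    ⟨idempotentBasis hmn, isCellIdempotent_idempotentBasis hmn,
      fun κ f hf => hf.eq_idempotentBasis hmn, cell_eq_sum_idempotentBasis hmn⟩,
    fun κ lam h => isGood_rect hmn h⟩
  · obtain ⟨x, y, z, hx, -, hz, hxy, hyz⟩ := exists_chain (O := O) (n := n) (by omega) hκ
    exact ⟨x, z, hx, hz, hxy.trans hyz⟩
  · obtain ⟨x, w, z, hx, hw, -, hxz, hzw⟩ := exists_general_position (O := O) hmn lam κ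
    exact ⟨x, w, hx, hw, eq_bot_iff.2 ((inf_le_inf_right w hxz).trans hzw.le)⟩
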